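/- Let $G=(V,E)$ be a finite simple undirected graph with $n$ vertices and $m$ edges. $G$ is a cocomparability graph if its complement has a transitive orientation. An ordering $\sigma$ of $V$ (a bijection from the positions $1,\dots,n$ to $V$) is a cocomparability ordering of $G$ if for all $a\prec_\sigma b\prec_\sigma c$ with $ac\in E$ we have $ab\in E$ or $bc\in E$. For an ordering $\sigma$ of $V$, $\mathrm{LexDFS}^+(\sigma)$ is the ordering $\tau$ of $V$ obtained as follows: initially all vertices are unnumbered and have the empty label; for $i=1,\dots,n$, among the unnumbered vertices with lexicographically largest label choose the one that is rightmost in $\sigma$, call it $\tau(i)$, and prepend $i$ to the label of each of its unnumbered neighbours. Proposition. There is an algorithm which, given a cocomparability graph $G$ (by adjacency lists) and a cocomparability ordering $\sigma$ of $G$, computes the ordering $\tau=\mathrm{LexDFS}^+(\sigma)$ in $\mathcal{O}(m+n)$ time. Precisely: there are a random access machine program (with unit-cost copy, addition, truncated subtraction, comparison and indexed memory access) and a constant $C$, such that for every such $G$ and $\sigma$ the program halts with output $\mathrm{LexDFS}^+(\sigma)$ after at most $C(n+m+1)$ steps, and no number larger than $C(n+m+1)$ is ever written to a register or memory cell. 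-/

import Mathlib

namespace CocompLexDFS

section Graphs

variable {V : Type*} {n : ℕ}

/-- `G` is a cocomparability graph: its complement has a transitive orientation, that is, there is
a strict partial order on the vertices in which two vertices are comparable exactly when they are
adjacent in the complement of `G`. -/
def IsCocomparabilityGraph (G : SimpleGraph V) : Prop :=
  ∃ r : V → V → Prop, IsStrictOrder V r ∧ ∀ u v, Gᶜ.Adj u v ↔ r u v ∨ r v u

/-- `σ` is a cocomparability (umbrella-free) ordering of `G`. An ordering of the `n` vertices is a
bijection from the positions `0, …, n - 1` to the vertices. -/
def IsCocomparabilityOrdering (G : SimpleGraph V) (σ : Fin n ≃ V) : Prop :=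
  ∀ i j k : Fin n, i < j → j < k →
    G.Adj (σ i) (σ k) → G.Adj (σ i) (σ j) ∨ G.Adj (σ j) (σ k)

open Classical in
/-- The LexDFS label of the vertex `w` after the first `i` vertices of `τ` have been numbered
`1, …, i`. All labels are empty at first; when the vertex in position `i` receives the number
`i + 1`, this number is prepended to the labels of its neighbours. (The label of a vertex is never
looked at again after the vertex has been numbered.) -/
noncomputable def lexDFSLabel (G : SimpleGraph V) (τ : Fin n ≃ V) : ℕ → V → List ℕ
  | 0, _ => []
  | i + 1, w =>
    if ∃ h : i < n, G.Adj (τ ⟨i, h⟩) w then (i + 1) :: lexDFSLabel G τ i w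
    else lexDFSLabel G τ i w

/-- `τ` is the ordering LexDFS⁺(`σ`) of `G`: in every step `i`, the vertex `τ i` has a
lexicographically largest label among the vertices that are not yet numbered (these are the `τ j`
with `i ≤ j`), and it is the rightmost one in `σ` among those of them that are tied, i.e. that
carry this largest label. The order on `List ℕ` is the lexicographic one. -/
structure IsLexDFSPlus (G : SimpleGraph V) (σ τ : Fin n ≃ V) : Prop where
  largest : ∀ i j : Fin n, i ≤ j → lexDFSLabel G τ i (τ j) ≤ lexDFSLabel G τ i (τ i)
  rightmost : ∀ i j : Fin n, i ≤ j →
    lexDFSLabel G τ i (τ j) = lexDFSLabel G τ i (τ i) → σ.symm (τ j) ≤ σ.symm (τ i)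

end Graphs

/-! Random access machine. The store consists of registers and of arrays; both are named by
natural numbers that are fixed in the program text, so that a program uses only finitely many
registers and arrays. The elementary instructions are: copy, addition, truncated subtraction,
reading and writing an array cell whose index is computed, and comparison. Each of them
takes one step. Words are limited to a size `W`. -/

/-- A store: the contents of the registers, and the contents of the cells of the arrays. -/
structure Store where
  reg : ℕ → ℕ
  arr : ℕ → ℕ → ℕ

/-- An operand is a constant of the program or the content of a register. -/
inductive Operand where
  | lit (k : ℕ)
  | reg (x : ℕ)

/-- The right-hand side of an assignment: a single elementary operation. -/
inductive Operation where
  | copy (a : Operand)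
  | add (a b : Operand)
  | sub (a b : Operand)
  | read (A : ℕ) (a : Operand)

/-- An elementary test. -/
inductive Test where
  | lt (a b : Operand)
  | eq (a b : Operand)

/-- Programs. `assign x e` puts the value of `e` into register `x`; `write A a b` puts the value
of `b` into the cell of array `A` whose index is the value of `a`. -/
inductive Program where
  | skip
  | assign (x : ℕ) (e : Operation)
  | write (A : ℕ) (a b : Operand)
  | seq (P Q : Program)
  | cond (b : Test) (P Q : Program)
  | loop (b : Test) (P : Program)

def Operand.val (s : Store) : Operand → ℕ
  | .lit k => k
  | .reg x => s.reg x

def Operation.val (s : Store) : Operation → ℕ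
  | .copy a => a.val s
  | .add a b => a.val s + b.val s
  | .sub a b => a.val s - b.val s
  | .read A a => s.arr A (a.val s)

def Test.holds (s : Store) : Test → Prop
  | .lt a b => a.val s < b.val s
  | .eq a b => a.val s = b.val s

def Store.setReg (s : Store) (x v : ℕ) : Store :=
  { s with reg := Function.update s.reg x v }

def Store.setCell (s : Store) (A i v : ℕ) : Store :=
  { s with arr := Function.update s.arr A (Function.update (s.arr A) i v) }

/-- `Exec W P s t s'`: started in the store `s`, the program `P` halts in the store `s'` after
exactly `t` steps, and no value greater than `W` is put into a register or a cell on the way.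
Every elementary instruction and every evaluation of a test counts as one step. -/
inductive Exec (W : ℕ) : Program → Store → ℕ → Store → Prop where
  | skip (s : Store) : Exec W .skip s 1 s
  | assign (s : Store) (x : ℕ) (e : Operation) (hW : e.val s ≤ W) :
      Exec W (.assign x e) s 1 (s.setReg x (e.val s))
  | write (s : Store) (A : ℕ) (a b : Operand) (hW : b.val s ≤ W) :
      Exec W (.write A a b) s 1 (s.setCell A (a.val s) (b.val s))
  | seq {P Q : Program} {s s₁ s₂ : Store} {t₁ t₂ : ℕ}
      (h₁ : Exec W P s t₁ s₁) (h₂ : Exec W Q s₁ t₂ s₂) :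
      Exec W (.seq P Q) s (t₁ + t₂) s₂
  | cond_true {b : Test} {P Q : Program} {s s' : Store} {t : ℕ}
      (hb : b.holds s) (h : Exec W P s t s') : Exec W (.cond b P Q) s (t + 1) s'
  | cond_false {b : Test} {P Q : Program} {s s' : Store} {t : ℕ}
      (hb : ¬ b.holds s) (h : Exec W Q s t s') : Exec W (.cond b P Q) s (t + 1) s'
  | loop_true {b : Test} {P : Program} {s s₁ s₂ : Store} {t₁ t₂ : ℕ}
      (hb : b.holds s) (h₁ : Exec W P s t₁ s₁) (h₂ : Exec W (.loop b P) s₁ t₂ s₂) :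
      Exec W (.loop b P) s (t₁ + t₂ + 1) s₂
  | loop_false {b : Test} {P : Program} {s : Store}
      (hb : ¬ b.holds s) : Exec W (.loop b P) s 1 s

/-- The store `s` holds the input `(G, σ)`: register `0` holds the number of vertices, arrays `0`
and `1` hold adjacency lists of `G`, and array `2` holds the ordering `σ`.
The adjacency list of the vertex `v` lists each neighbour of `v` exactly once, in an arbitrary
order; it occupies the cells of array `1` from the index `arr 0 v` (inclusive) to the index
`arr 0 (v + 1)` (exclusive). All other registers and arrays are initially zero. -/
structure IsInput {n : ℕ} (G : SimpleGraph (Fin n)) (σ : Fin n ≃ Fin n) (s : Store) : Prop where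
  size : s.reg 0 = n
  reg_zero : ∀ x, x ≠ 0 → s.reg x = 0
  start : s.arr 0 0 = 0
  adjList : ∀ v : Fin n, ∃ l : List (Fin n), l.Nodup ∧ (∀ u, u ∈ l ↔ G.Adj v u) ∧
    s.arr 0 (v + 1) = s.arr 0 v + l.length ∧
    ∀ (k : ℕ) (hk : k < l.length), s.arr 1 (s.arr 0 v + k) = (l[k] : ℕ)
  order : ∀ i : Fin n, s.arr 2 i = (σ i : ℕ)
  arr_zero : ∀ A, 3 ≤ A → ∀ i, s.arr A i = 0

/-- The store `s` holds the ordering `τ` as output, in array `3`. -/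
def IsOutput {n : ℕ} (τ : Fin n ≃ Fin n) (s : Store) : Prop :=
  ∀ i : Fin n, s.arr 3 i = (τ i : ℕ)

end CocompLexDFS

open CocompLexDFS

/-!
Write `pos` for the inverse of `σ`, and let `u` be below `w` if `pos w < pos u` and `u`, `w` are not
adjacent. Since `σ` has no umbrella, this is a strict partial order, the only consequence of the
hypotheses that is needed. The height `lev w` of a vertex is the length of a longest chain that
ends in `w`. The vertices of one height are pairwise adjacent, and LexDFS⁺ numbers the vertices
height by height. This reduces the problem to the comparison of vertices of the same height, whose
labels differ only by neighbours of smaller height, all of which have been numbered before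
(`OrderedGraph.IsLevel.lexDFSPlus_rule`).

All heights are found in linear time by going through `σ` from right to left: the height of `w` is
one more than the largest `k` such that not all the vertices of height `k` so far are neighbours of
`w`, and every level that is skipped in the search for `k` contains a neighbour of `w`
(`OrderedGraph.LevelInv.exists_top`, `OrderedGraph.LevelInv.step`).

A level is then sorted by partition refinement. When a vertex `x` gets its number `q`, the event
`(q, u)` is pushed for each neighbour `u` of `x` onto a stack for the level of `u`. The stack of a
level thus holds the labels of its vertices with the most significant entries first. An event
`(q, w)` moves `w` from its class, with label `l`, to the class with label `l ++ [q]`. In the list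
of all classes, in the order of the labels, the place of this class is right after the class of
`w`, so that it is found, or created, in constant time (`append_singleton_le`,
`ClassInv.label_next`). Ties are broken by the same mechanism: at the bottom of the stacks, each
vertex has an event of its own, whose pivot is its position in `σ`. These pivots are smaller than
all numbers given out later, since those are shifted by `n`. In the end each vertex is in a class
that was created by its own tie-breaking event, and the class list gives the order of the level
(`OrderedGraph.finalVertices_spec`, `OrderedGraph.Numbering.step`).

The program is verified with the predicate `wp` and with a rule for loops whose number of
iterations is known beforehand (`wp_loop`).
-/

namespace CocompLexDFS

/-! ### A calculus for timed executions -/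

/-- `wp W P Q t s`: with `t` steps already spent, running `P` from `s` within the word size `W`
halts in some store `s'`, and `Q` holds of the total number of steps and of `s'`. -/
def wp (W : ℕ) (P : Program) (Q : ℕ → Store → Prop) (t : ℕ) (s : Store) : Prop :=
  ∃ t' s', Exec W P s t' s' ∧ Q (t + t') s'

section Calculus

variable {W t : ℕ} {s : Store} {Q : ℕ → Store → Prop}

theorem wp_skip : wp W .skip Q t s ↔ Q (t + 1) s := by
  constructor
  · rintro ⟨_, _, h, hQ⟩
    cases h
    exact hQ
  · exact fun h => ⟨1, s, .skip s, h⟩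

theorem wp_assign {x : ℕ} {e : Operation} :
    wp W (.assign x e) Q t s ↔ e.val s ≤ W ∧ Q (t + 1) (s.setReg x (e.val s)) := by
  constructor
  · rintro ⟨_, _, h, hQ⟩
    cases h with
    | assign _ _ _ hW => exact ⟨hW, hQ⟩
  · exact fun h => ⟨1, _, .assign s x e h.1, h.2⟩

theorem wp_write {A : ℕ} {a b : Operand} :
    wp W (.write A a b) Q t s ↔ b.val s ≤ W ∧ Q (t + 1) (s.setCell A (a.val s) (b.val s)) := by
  constructor
  · rintro ⟨_, _, h, hQ⟩
    cases h with
    | write _ _ _ _ hW => exact ⟨hW, hQ⟩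
  · exact fun h => ⟨1, _, .write s A a b h.1, h.2⟩

theorem wp_seq {P R : Program} : wp W (.seq P R) Q t s ↔ wp W P (wp W R Q) t s := by
  constructor
  · rintro ⟨_, _, h, hQ⟩
    cases h with
    | seq h₁ h₂ => exact ⟨_, _, h₁, _, _, h₂, by rwa [Nat.add_assoc]⟩
  · rintro ⟨_, _, h₁, _, _, h₂, hQ⟩
    exact ⟨_, _, .seq h₁ h₂, by rwa [← Nat.add_assoc]⟩

theorem wp_cond {b : Test} {P R : Program} :
    wp W (.cond b P R) Q t s ↔
      (b.holds s → wp W P Q (t + 1) s) ∧ (¬ b.holds s → wp W R Q (t + 1) s) := by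
  constructor
  · rintro ⟨_, _, h, hQ⟩
    cases h with
    | cond_true hb h =>
      exact ⟨fun _ => ⟨_, _, h, by rwa [Nat.add_assoc, Nat.add_comm 1]⟩, fun h' => (h' hb).elim⟩
    | cond_false hb h =>
      exact ⟨fun h' => (hb h').elim, fun _ => ⟨_, _, h, by rwa [Nat.add_assoc, Nat.add_comm 1]⟩⟩
  · rintro ⟨h₁, h₂⟩
    by_cases hb : b.holds s
    · obtain ⟨t', s', h, hQ⟩ := h₁ hb
      exact ⟨_, _, .cond_true hb h, by rwa [Nat.add_assoc, Nat.add_comm 1] at hQ⟩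
    · obtain ⟨t', s', h, hQ⟩ := h₂ hb
      exact ⟨_, _, .cond_false hb h, by rwa [Nat.add_assoc, Nat.add_comm 1] at hQ⟩

end Calculus

/-- The program contains an assignment to the register `x`. -/
def Program.setsReg (x : ℕ) : Program → Bool
  | .skip => false
  | .assign y _ => x == y
  | .write _ _ _ => false
  | .seq P Q => P.setsReg x || Q.setsReg x
  | .cond _ P Q => P.setsReg x || Q.setsReg x
  | .loop _ P => P.setsReg x

/-- The program contains a write into the array `A`. -/
def Program.setsArr (A : ℕ) : Program → Bool
  | .skip => false
  | .assign _ _ => false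
  | .write B _ _ => A == B
  | .seq P Q => P.setsArr A || Q.setsArr A
  | .cond _ P Q => P.setsArr A || Q.setsArr A
  | .loop _ P => P.setsArr A

/-- The stores `s` and `s'` agree on everything that the text of `P` does not write to. -/
structure Frame (P : Program) (s s' : Store) : Prop where
  reg : ∀ x, P.setsReg x = false → s'.reg x = s.reg x
  arr : ∀ A, P.setsArr A = false → s'.arr A = s.arr A

theorem Exec.frame {W : ℕ} {P : Program} {s s' : Store} {t : ℕ} (h : Exec W P s t s') :
    Frame P s s' := by
  induction h with
  | skip s => exact ⟨fun _ _ => rfl, fun _ _ => rfl⟩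
  | assign s x e hW =>
    refine ⟨fun y hy => ?_, fun _ _ => rfl⟩
    have : y ≠ x := by simpa [Program.setsReg] using hy
    simp [Store.setReg, this]
  | write s A a b hW =>
    refine ⟨fun _ _ => rfl, fun B hB => ?_⟩
    have : B ≠ A := by simpa [Program.setsArr] using hB
    simp [Store.setCell, this]
  | seq _ _ ih₁ ih₂ =>
    refine ⟨fun y hy => ?_, fun B hB => ?_⟩
    · simp only [Program.setsReg, Bool.or_eq_false_iff] at hy
      rw [ih₂.reg y hy.2, ih₁.reg y hy.1]
    · simp only [Program.setsArr, Bool.or_eq_false_iff] at hB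
      rw [ih₂.arr B hB.2, ih₁.arr B hB.1]
  | cond_true _ _ ih =>
    refine ⟨fun y hy => ?_, fun B hB => ?_⟩
    · simp only [Program.setsReg, Bool.or_eq_false_iff] at hy
      exact ih.reg y hy.1
    · simp only [Program.setsArr, Bool.or_eq_false_iff] at hB
      exact ih.arr B hB.1
  | cond_false _ _ ih =>
    refine ⟨fun y hy => ?_, fun B hB => ?_⟩
    · simp only [Program.setsReg, Bool.or_eq_false_iff] at hy
      exact ih.reg y hy.2
    · simp only [Program.setsArr, Bool.or_eq_false_iff] at hB
      exact ih.arr B hB.2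
  | loop_true _ _ _ ih₁ ih₂ =>
    refine ⟨fun y hy => ?_, fun B hB => ?_⟩
    · rw [ih₂.reg y hy, ih₁.reg y hy]
    · rw [ih₂.arr B hB, ih₁.arr B hB]
  | loop_false _ => exact ⟨fun _ _ => rfl, fun _ _ => rfl⟩

/-- A loop whose number `N` of iterations is known in advance (to the proof, not to the program):
`I k` holds after `k` iterations, and the iteration number `k` takes at most `cost k` steps. -/
theorem wp_loop {W t : ℕ} {s : Store} {Q : ℕ → Store → Prop} {b : Test} {P : Program}
    (I : ℕ → Store → Prop) (N : ℕ) (cost : ℕ → ℕ) (init : I 0 s)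
    (step : ∀ k s', k < N → Frame P s s' → I k s' →
      b.holds s' ∧ wp W P (fun t' s'' => t' ≤ cost k ∧ I (k + 1) s'') 0 s')
    (exit : ∀ s', Frame P s s' → I N s' → ¬ b.holds s')
    (post : ∀ t' s', t' ≤ t + ∑ k ∈ Finset.range N, (cost k + 1) + 1 → Frame P s s' → I N s' →
      Q t' s') : wp W (.loop b P) Q t s := by
  have key : ∀ j k s', k + j = N → Frame P s s' → I k s' →
      ∃ t' s'', Exec W (.loop b P) s' t' s'' ∧ I N s'' ∧
        t' + ∑ i ∈ Finset.range k, (cost i + 1) ≤ ∑ i ∈ Finset.range N, (cost i + 1) + 1 := by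
    intro j
    induction j with
    | zero =>
      intro k s' hk hf hI
      obtain rfl : k = N := hk
      exact ⟨1, s', .loop_false (exit s' hf hI), hI, by omega⟩
    | succ j ih =>
      intro k s' hk hf hI
      obtain ⟨hb, t₁, s₁, h₁, ht₁, hI₁⟩ := step k s' (by omega) hf hI
      have hf₁ : Frame P s s₁ :=
        ⟨fun x hx => (h₁.frame.reg x hx).trans (hf.reg x hx),
          fun A hA => (h₁.frame.arr A hA).trans (hf.arr A hA)⟩
      obtain ⟨t₂, s₂, h₂, hI₂, ht₂⟩ := ih (k + 1) s₁ (by omega) hf₁ hI₁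
      refine ⟨_, s₂, .loop_true hb h₁ h₂, hI₂, ?_⟩
      rw [Finset.sum_range_succ] at ht₂
      omega
  obtain ⟨t', s', h, hI, ht⟩ := key N 0 s (by simp) ⟨fun _ _ => rfl, fun _ _ => rfl⟩ init
  refine ⟨t', s', h, post _ _ ?_ ⟨h.frame.reg, h.frame.arr⟩ hI⟩
  simp only [Finset.range_zero, Finset.sum_empty] at ht
  omega

/-! ### Cocomparability orderings and LexDFS labels on natural numbers -/

/-- An umbrella-free ordered graph on the vertices `0, …, n - 1`, as the program sees it: `N v` is
the adjacency list of `v`, `π i` the vertex in position `i` and `pos v` the position of `v`. -/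
structure OrderedGraph where
  n : ℕ
  N : ℕ → List ℕ
  π : ℕ → ℕ
  pos : ℕ → ℕ
  nodup : ∀ v, v < n → (N v).Nodup
  lt : ∀ v, v < n → ∀ u ∈ N v, u < n
  symm : ∀ v, v < n → ∀ u, u < n → u ∈ N v → v ∈ N u
  irrefl : ∀ v, v < n → v ∉ N v
  π_lt : ∀ i, i < n → π i < n
  pos_lt : ∀ v, v < n → pos v < n
  pos_π : ∀ i, i < n → pos (π i) = i
  π_pos : ∀ v, v < n → π (pos v) = v
  umbrella : ∀ u, u < n → ∀ v, v < n → ∀ w, w < n → pos u < pos v → pos v < pos w →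
    w ∈ N u → v ∈ N u ∨ w ∈ N v

namespace OrderedGraph

variable (D : OrderedGraph)

/-- `u` precedes `w` in the poset of the ordered graph: the vertices are not adjacent, and `u` is
to the right of `w`. -/
def Below (u w : ℕ) : Prop := D.pos w < D.pos u ∧ w ∉ D.N u

/-- `lev` assigns to each vertex its height in the poset `Below`, where minimal elements have
height `1`. -/
structure IsLevel (lev : ℕ → ℕ) : Prop where
  pos : ∀ v, v < D.n → 1 ≤ lev v
  lt : ∀ u, u < D.n → ∀ w, w < D.n → D.Below u w → lev u < lev w
  pred : ∀ w, w < D.n → 2 ≤ lev w → ∃ u, u < D.n ∧ D.Below u w ∧ lev u + 1 = lev w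

/-- The LexDFS label of `w` after the vertices `t 0, …, t (i - 1)` have been numbered. -/
def lbl (t : ℕ → ℕ) : ℕ → ℕ → List ℕ
  | 0, _ => []
  | i + 1, w => if w ∈ D.N (t i) then (i + 1) :: lbl t i w else lbl t i w

variable {D}

theorem pos_inj {u v : ℕ} (hu : u < D.n) (hv : v < D.n) (h : D.pos u = D.pos v) : u = v := by
  rw [← D.π_pos u hu, h, D.π_pos v hv]

theorem Below.trans {u v w : ℕ} (hu : u < D.n) (hv : v < D.n) (hw : w < D.n)
    (h₁ : D.Below u v) (h₂ : D.Below v w) : D.Below u w := by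
  refine ⟨h₂.1.trans h₁.1, fun h => ?_⟩
  rcases D.umbrella w hw v hv u hu h₂.1 h₁.1 (D.symm u hu w hw h) with h | h
  · exact h₂.2 (D.symm w hw v hv h)
  · exact h₁.2 (D.symm v hv u hu h)

variable {lev t : ℕ → ℕ}

theorem IsLevel.exists_below (hL : D.IsLevel lev) {g : ℕ} (hg : 1 ≤ g) {w : ℕ} (hw : w < D.n)
    (h : g < lev w) : ∃ u, u < D.n ∧ D.Below u w ∧ lev u = g := by
  induction hk : lev w - g generalizing w with
  | zero => omega
  | succ k ih =>
    obtain ⟨v, hv, hb, hl⟩ := hL.pred w hw (by omega)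
    rcases Nat.lt_or_ge g (lev v) with h' | h'
    · obtain ⟨u, hu, hb', hl'⟩ := ih hv h' (by omega)
      exact ⟨u, hu, hb'.trans hu hv hw hb, hl'⟩
    · exact ⟨v, hv, hb, by omega⟩

/-- Levels are antichains of the poset, that is, cliques of the graph. -/
theorem IsLevel.adj (hL : D.IsLevel lev) {u w : ℕ} (hu : u < D.n) (hw : w < D.n) (hne : u ≠ w)
    (h : lev u = lev w) : w ∈ D.N u := by
  by_contra hn
  rcases Nat.lt_trichotomy (D.pos u) (D.pos w) with h' | h' | h'
  · have := hL.lt w hw u hu ⟨h', fun h'' => hn (D.symm w hw u hu h'')⟩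
    omega
  · exact hne (pos_inj hu hw h')
  · have := hL.lt u hu w hw ⟨h', hn⟩
    omega

theorem lbl_congr {t' : ℕ → ℕ} {i : ℕ} (h : ∀ k, k < i → t k = t' k) (w : ℕ) :
    D.lbl t i w = D.lbl t' i w := by
  induction i with
  | zero => rfl
  | succ i ih => rw [lbl, lbl, ih (fun k hk => h k (by omega)), h i (by omega)]

theorem le_of_mem_lbl {i w a : ℕ} (h : a ∈ D.lbl t i w) : a ≤ i := by
  induction i with
  | zero => simp [lbl] at h
  | succ i ih =>
    rw [lbl] at h
    split_ifs at h
    · rcases List.mem_cons.1 h with rfl | h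
      · exact le_rfl
      · exact (ih h).trans (Nat.le_succ i)
    · exact (ih h).trans (Nat.le_succ i)

theorem lbl_lt_cons (i w : ℕ) (l : List ℕ) : D.lbl t i w < (i + 1) :: l := by
  rcases h : D.lbl t i w with _ | ⟨a, l'⟩
  · exact List.nil_lt_cons _ _
  · have : a ≤ i := le_of_mem_lbl (w := w) (t := t) (D := D) (by simp [h])
    exact List.cons_lt_cons_iff.2 (Or.inl (by omega))

/-- The latest numbered vertex that is adjacent to exactly one of `x` and `y` decides. -/
theorem lbl_lt_lbl {i k x y : ℕ} (hk : k < i) (hx : x ∈ D.N (t k)) (hy : y ∉ D.N (t k))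
    (h : ∀ k', k < k' → k' < i → (x ∈ D.N (t k') ↔ y ∈ D.N (t k'))) :
    D.lbl t i y < D.lbl t i x := by
  induction i with
  | zero => omega
  | succ i ih =>
    rcases Nat.lt_succ_iff_lt_or_eq.1 hk with hk' | rfl
    · have ih := ih hk' fun k' h₁ h₂ => h k' h₁ (by omega)
      have := h i hk' (by omega)
      rw [lbl, lbl]
      by_cases hxi : x ∈ D.N (t i)
      · rw [if_pos hxi, if_pos (this.1 hxi)]
        exact List.cons_lt_cons_iff.2 (Or.inr ⟨rfl, ih⟩)
      · rwa [if_neg hxi, if_neg (fun h' => hxi (this.2 h'))]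
    · rw [lbl, lbl, if_pos hx, if_neg hy]
      exact lbl_lt_cons k y _

theorem lbl_le_lbl {i x y : ℕ} (h : ∀ k, k < i → y ∈ D.N (t k) → x ∈ D.N (t k)) :
    D.lbl t i y ≤ D.lbl t i x := by
  induction i with
  | zero => exact le_refl _
  | succ i ih =>
    have ih := ih fun k hk => h k (by omega)
    rw [lbl, lbl]
    by_cases hy : y ∈ D.N (t i)
    · rw [if_pos hy, if_pos (h i (by omega) hy)]
      rcases ih.lt_or_eq with h' | h'
      · exact le_of_lt (List.cons_lt_cons_iff.2 (Or.inr ⟨rfl, h'⟩))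
      · exact le_of_eq (by rw [h'])
    · rw [if_neg hy]
      split_ifs
      · exact le_of_lt (lbl_lt_cons i y _)
      · exact ih

/-- A numbering that lists the levels one after the other, and that obeys the LexDFS⁺ rule in the
comparison of any two vertices of the same level, obeys it altogether. If `y` is on a higher level
than `x`, either some vertex on the level of `x` was numbered before `x` and is not adjacent to `y`,
and the latest such vertex is decisive, or some `u` on the level of `x` that is below `y` is not yet
numbered, and the label of `u` lies between those of `y` and `x`. -/
theorem IsLevel.lexDFSPlus_rule (hL : D.IsLevel lev) (ht : ∀ p, p < D.n → t p < D.n)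
    (inj : ∀ p, p < D.n → ∀ q, q < D.n → t p = t q → p = q)
    (surj : ∀ v, v < D.n → ∃ p, p < D.n ∧ t p = v)
    (mono : ∀ p q, p ≤ q → q < D.n → lev (t p) ≤ lev (t q))
    (same : ∀ p q, p < q → q < D.n → lev (t p) = lev (t q) →
      D.lbl t p (t q) < D.lbl t p (t p) ∨
        D.lbl t p (t q) = D.lbl t p (t p) ∧ D.pos (t q) < D.pos (t p))
    {p q : ℕ} (hpq : p ≤ q) (hq : q < D.n) :
    D.lbl t p (t q) ≤ D.lbl t p (t p) ∧
      (D.lbl t p (t q) = D.lbl t p (t p) → D.pos (t q) ≤ D.pos (t p)) := by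
  have hp : p < D.n := by omega
  have same' : ∀ q, p ≤ q → q < D.n → lev (t p) = lev (t q) →
      D.lbl t p (t q) ≤ D.lbl t p (t p) ∧
      (D.lbl t p (t q) = D.lbl t p (t p) → D.pos (t q) ≤ D.pos (t p)) := by
    intro q hpq hq h
    rcases hpq.eq_or_lt with rfl | hpq
    · exact ⟨le_refl _, fun _ => le_rfl⟩
    · rcases same p q hpq hq h with h' | ⟨h', h''⟩
      · exact ⟨le_of_lt h', fun e => absurd e (ne_of_lt h')⟩
      · exact ⟨le_of_eq h', fun _ => h''.le⟩
  rcases (mono p q hpq hq).eq_or_lt with h | h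
  · exact same' q hpq hq h
  by_cases hk : ∃ k, k < p ∧ lev (t k) = lev (t p) ∧ t q ∉ D.N (t k)
  · obtain ⟨k, hkp, hkl, hkq⟩ := hk
    have adj : ∀ k, k < p → lev (t k) = lev (t p) → t p ∈ D.N (t k) := fun k hk h =>
      hL.adj (ht k (by omega)) (ht p hp)
        (fun e => by have := inj k (by omega) p hp e; omega) h
    classical
    let S := (Finset.range p).filter fun k => ¬ (t p ∈ D.N (t k) ↔ t q ∈ D.N (t k))
    have hkS : k ∈ S := by simp [S, hkp, hkq, adj k hkp hkl]
    have hm := S.max'_mem ⟨k, hkS⟩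
    have hle := S.le_max' k hkS
    set m := S.max' ⟨k, hkS⟩ with hmdef
    simp only [S, Finset.mem_filter, Finset.mem_range] at hm
    have hml : lev (t m) = lev (t p) :=
      le_antisymm (mono m p hm.1.le hp) (hkl ▸ mono k m hle (by omega))
    have hmp := adj m hm.1 hml
    have : D.lbl t p (t q) < D.lbl t p (t p) := by
      refine lbl_lt_lbl hm.1 hmp (fun h' => hm.2 ⟨fun _ => h', fun _ => hmp⟩) fun k' h₁ h₂ => ?_
      by_contra hne
      have := S.le_max' k' (by simp only [S, Finset.mem_filter, Finset.mem_range]; exact ⟨h₂, hne⟩)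
      omega
    exact ⟨le_of_lt this, fun e => absurd e (ne_of_lt this)⟩
  · obtain ⟨u, hu, hb, hul⟩ := hL.exists_below (hL.pos _ (ht p hp)) (ht q hq) h
    obtain ⟨r, hr, rfl⟩ := surj u hu
    have hpr : p ≤ r := by
      by_contra hlt
      exact hk ⟨r, by omega, hul, hb.2⟩
    obtain ⟨h₁, h₂⟩ := same' r hpr hr hul.symm
    have h₃ : D.lbl t p (t q) ≤ D.lbl t p (t r) := by
      refine lbl_le_lbl fun k hk hkq => ?_
      by_contra hkr
      have hkn : t k < D.n := ht k (by omega)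
      rcases Nat.lt_trichotomy (D.pos (t k)) (D.pos (t r)) with h' | h' | h'
      · have := hL.lt _ hu _ hkn ⟨h', fun h'' => hkr (D.symm _ hu _ hkn h'')⟩
        have := mono k p hk.le hp
        omega
      · have := inj k (by omega) r hr (pos_inj hkn hu h')
        omega
      · exact (Below.trans hkn hu (ht q hq) ⟨h', hkr⟩ hb).2 hkq
    refine ⟨h₃.trans h₁, fun e => ?_⟩
    have e' := le_antisymm h₁ (e ▸ h₃)
    exact hb.1.le.trans (h₂ e')

/-! ### Events -/

variable (D)

/-- The events that encode the tie-breaking by `σ`, the latest first: it is as if the vertex in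
position `i` had a private neighbour, numbered `i + 1`. -/
def tieEvents : ℕ → List (ℕ × ℕ)
  | 0 => []
  | i + 1 => (i + 1, D.π i) :: tieEvents i

/-- All events after the vertices `t 0, …, t (p - 1)` have been numbered, the latest first. The
event `(q, w)` says that `q` is prepended to the label of `w`. The numbers that LexDFS gives out are
shifted by `n`, which makes them larger than those of the tie-breaking events. -/
def events (t : ℕ → ℕ) : ℕ → List (ℕ × ℕ)
  | 0 => D.tieEvents D.n
  | p + 1 => (D.N (t p)).reverse.map (fun u => (D.n + p + 1, u)) ++ events t p

/-- The pivots of the events in `l` at the vertex `w`. -/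
def labelOf (l : List (ℕ × ℕ)) (w : ℕ) : List ℕ := (l.filter fun e => e.2 = w).map Prod.fst

variable {D}

theorem labelOf_append (l l' : List (ℕ × ℕ)) (w : ℕ) :
    labelOf (l ++ l') w = labelOf l w ++ labelOf l' w := by
  simp [labelOf]

theorem labelOf_singleton (e : ℕ × ℕ) (w : ℕ) :
    labelOf [e] w = if e.2 = w then [e.1] else [] := by
  by_cases h : e.2 = w <;> simp [labelOf, h]

theorem mem_labelOf {l : List (ℕ × ℕ)} {w q : ℕ} : q ∈ labelOf l w ↔ (q, w) ∈ l := by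
  simp [labelOf]

theorem mem_tieEvents {i q w : ℕ} : (q, w) ∈ D.tieEvents i ↔ 1 ≤ q ∧ q ≤ i ∧ w = D.π (q - 1) := by
  induction i with
  | zero => simp [tieEvents]; omega
  | succ i ih =>
    simp only [tieEvents, List.mem_cons, Prod.mk.injEq, ih]
    constructor
    · rintro (⟨rfl, rfl⟩ | h)
      · simp
      · exact ⟨h.1, by omega, h.2.2⟩
    · rintro ⟨h₁, h₂, h₃⟩
      rcases Nat.lt_succ_iff_lt_or_eq.1 (Nat.lt_succ_of_le h₂) with h | rfl
      · exact Or.inr ⟨h₁, by omega, h₃⟩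
      · exact Or.inl ⟨rfl, by simpa using h₃⟩

theorem mem_events {p q w : ℕ} : (q, w) ∈ D.events t p ↔
    (1 ≤ q ∧ q ≤ D.n ∧ w = D.π (q - 1)) ∨ ∃ k, k < p ∧ q = D.n + k + 1 ∧ w ∈ D.N (t k) := by
  induction p with
  | zero => simp [events, mem_tieEvents]
  | succ p ih =>
    simp only [events, List.mem_append, ih, List.mem_map, List.mem_reverse, Prod.mk.injEq]
    constructor
    · rintro (⟨u, hu, rfl, rfl⟩ | h | ⟨k, hk, h⟩)
      · exact Or.inr ⟨p, by omega, rfl, hu⟩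
      · exact Or.inl h
      · exact Or.inr ⟨k, by omega, h⟩
    · rintro (h | ⟨k, hk, rfl, hw⟩)
      · exact Or.inr (Or.inl h)
      · rcases Nat.lt_succ_iff_lt_or_eq.1 hk with hk | rfl
        · exact Or.inr (Or.inr ⟨k, hk, rfl, hw⟩)
        · exact Or.inl ⟨w, hw, rfl, rfl⟩

/-- The pivots of a list of events are weakly decreasing, and strictly so at each vertex. -/
def Descending (l : List (ℕ × ℕ)) : Prop :=
  l.Pairwise fun e e' => e'.1 ≤ e.1 ∧ (e.2 = e'.2 → e'.1 < e.1)

theorem descending_tieEvents (i : ℕ) : Descending (D.tieEvents i) := by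
  induction i with
  | zero => exact List.Pairwise.nil
  | succ i ih =>
    refine List.pairwise_cons.2 ⟨?_, ih⟩
    rintro ⟨q, w⟩ h
    rw [mem_tieEvents] at h
    exact ⟨by simp; omega, fun _ => by simp; omega⟩

theorem descending_events {p : ℕ} (ht : ∀ k, k < p → t k < D.n) : Descending (D.events t p) := by
  induction p with
  | zero => exact descending_tieEvents _
  | succ p ih =>
    refine List.pairwise_append.2 ⟨?_, ih fun k hk => ht k (by omega), ?_⟩
    · rw [List.pairwise_map]
      have := List.nodup_reverse.2 (D.nodup _ (ht p (by omega)))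
      exact List.Pairwise.imp (fun h => ⟨le_rfl, fun e => absurd e h⟩) this
    · rintro ⟨q, w⟩ h ⟨q', w'⟩ h'
      rw [mem_events] at h'
      simp only [List.mem_map, Prod.mk.injEq] at h
      obtain ⟨_, _, rfl, _⟩ := h
      have : q' < D.n + p + 1 := by
        rcases h' with h' | ⟨k, hk, rfl, _⟩ <;> omega
      exact ⟨this.le, fun _ => this⟩

theorem labelOf_tieEvents {i w : ℕ} (hi : i ≤ D.n) (hw : w < D.n) :
    labelOf (D.tieEvents i) w = if D.pos w < i then [D.pos w + 1] else [] := by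
  induction i with
  | zero => simp [labelOf, tieEvents]
  | succ i ih =>
    rw [tieEvents, ← List.singleton_append, labelOf_append, labelOf_singleton, ih (by omega)]
    by_cases h : D.π i = w
    · subst h
      simp [D.pos_π i (by omega)]
    · have : D.pos w ≠ i := fun e => h (by rw [← e, D.π_pos w hw])
      rw [if_neg h, List.nil_append]
      congr 1
      simp; omega

theorem labelOf_events {p w : ℕ} (hw : w < D.n) (ht : ∀ k, k < p → t k < D.n) :
    labelOf (D.events t p) w = (D.lbl t p w).map (· + D.n) ++ [D.pos w + 1] := by
  induction p with
  | zero => simp [events, lbl, labelOf_tieEvents le_rfl hw, D.pos_lt w hw]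
  | succ p ih =>
    rw [events, labelOf_append, ih fun k hk => ht k (by omega), lbl]
    have : labelOf ((D.N (t p)).reverse.map fun u => (D.n + p + 1, u)) w =
        if w ∈ D.N (t p) then [D.n + p + 1] else [] := by
      have hnd := List.nodup_reverse.2 (D.nodup _ (ht p (by omega)))
      simp only [labelOf, List.filter_map, List.map_map]
      have hc : ((fun e : ℕ × ℕ => decide (e.2 = w)) ∘ fun u => (D.n + p + 1, u)) =
          fun u => u == w := by
        funext u; simp [beq_eq_decide]
      rw [hc, List.filter_beq, hnd.count]
      split_ifs <;> simp_all
    rw [this]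
    split_ifs <;> simp; omega

theorem pos_of_mem_lbl {i w a : ℕ} (h : a ∈ D.lbl t i w) : 1 ≤ a := by
  induction i with
  | zero => simp [lbl] at h
  | succ i ih =>
    rw [lbl] at h
    split_ifs at h
    · rcases List.mem_cons.1 h with rfl | h
      · omega
      · exact ih h
    · exact ih h

theorem length_lbl_le {p w : ℕ} (hw : w < D.n) (ht : ∀ k, k < p → t k < D.n)
    (inj : ∀ k, k < p → ∀ l, l < p → t k = t l → k = l) :
    (D.lbl t p w).length ≤ (D.N w).length := by
  have h₁ : (D.lbl t p w).length = ((Finset.range p).filter fun k => w ∈ D.N (t k)).card := by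
    clear ht inj
    induction p with
    | zero => simp [lbl]
    | succ p ih =>
      rw [lbl, Finset.range_add_one, Finset.filter_insert]
      split_ifs
      · rw [Finset.card_insert_of_notMem (by simp), List.length_cons, ih]
      · exact ih
  rw [h₁, ← List.toFinset_card_of_nodup (D.nodup w hw)]
  refine Finset.card_le_card_of_injOn t (fun k hk => ?_) fun k hk l hl e => ?_
  · simp only [Finset.coe_filter, Finset.mem_range, Set.mem_ofPred_eq] at hk
    simpa using D.symm _ (ht k hk.1) _ hw hk.2
  · simp only [Finset.coe_filter, Finset.mem_range, Set.mem_ofPred_eq] at hk hl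
    exact inj k hk.1 l hl.1 e

theorem shifted_lt {l l' : List ℕ} {n a b : ℕ} (h' : ∀ x ∈ l', 1 ≤ x) (hb : b ≤ n)
    (hl : ∀ x ∈ l, 1 ≤ x)
    (h : l.map (· + n) ++ [a] < l'.map (· + n) ++ [b]) : l < l' ∨ l = l' ∧ a < b := by
  induction l generalizing l' with
  | nil =>
    cases l' with
    | nil => simpa [List.cons_lt_cons_iff] using h
    | cons y l' => exact Or.inl (List.nil_lt_cons _ _)
  | cons x l ih =>
    cases l' with
    | nil =>
      have := hl x (by simp)
      simp only [List.map_cons, List.cons_append, List.map_nil, List.nil_append,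
        List.cons_lt_cons_iff] at h
      omega
    | cons y l' =>
      simp only [List.map_cons, List.cons_append, List.cons_lt_cons_iff, List.cons.injEq] at h ⊢
      rcases h with h | ⟨h₁, h₂⟩
      · exact Or.inl (Or.inl (by omega))
      · have : x = y := by omega
        rcases ih (fun z hz => h' z (by simp [hz])) (fun z hz => hl z (by simp [hz])) h₂ with h | h
        · exact Or.inl (Or.inr ⟨this, h⟩)
        · exact Or.inr ⟨⟨this, h.1⟩, h.2⟩

end OrderedGraph

/-! ### Linked lists -/

/-- The linked list that starts in the cell `a` of the array `nx` of links runs through the cells in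
`l`. A zero link ends the list. -/
def Linked (nx : ℕ → ℕ) : ℕ → List ℕ → Prop
  | a, [] => a = 0
  | a, x :: xs => a = x ∧ x ≠ 0 ∧ Linked nx (nx x) xs

theorem Linked.congr {nx nx' : ℕ → ℕ} {a : ℕ} {l : List ℕ} (h : ∀ x ∈ l, nx' x = nx x)
    (hl : Linked nx a l) : Linked nx' a l := by
  induction l generalizing a with
  | nil => exact hl
  | cons x l ih =>
    refine ⟨hl.1, hl.2.1, ?_⟩
    rw [h x (by simp)]
    exact ih (fun y hy => h y (by simp [hy])) hl.2.2

theorem Linked.drop {nx : ℕ → ℕ} {a c : ℕ} {A B : List ℕ} (h : Linked nx a (A ++ c :: B)) :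
    Linked nx (nx c) B := by
  induction A generalizing a with
  | nil => exact h.2.2
  | cons x A ih => exact ih h.2.2

/-- Insertion of a new cell `d` after the cell `c`. -/
theorem Linked.insert {nx : ℕ → ℕ} {a c d : ℕ} {A B : List ℕ} (h : Linked nx a (A ++ c :: B))
    (hn : (A ++ c :: B).Nodup) (hd : d ≠ 0) (hd' : d ∉ A ++ c :: B) :
    Linked (Function.update (Function.update nx d (nx c)) c d) a (A ++ c :: d :: B) := by
  induction A generalizing a with
  | nil =>
    simp only [List.nil_append, List.nodup_cons, List.mem_cons, not_or] at hn hd'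
    refine ⟨h.1, h.2.1, by simp, hd, ?_⟩
    rw [Function.update_of_ne hd'.1, Function.update_self]
    refine Linked.congr (fun x hx => ?_) h.2.2
    rw [Function.update_of_ne, Function.update_of_ne]
    · rintro rfl; exact hd'.2 hx
    · rintro rfl; exact hn.1 hx
  | cons x A ih =>
    simp only [List.cons_append, List.nodup_cons, List.mem_cons, not_or] at hn hd'
    refine ⟨h.1, h.2.1, ?_⟩
    rw [Function.update_of_ne, Function.update_of_ne (fun e => hd'.1 e.symm)]
    · exact ih h.2.2 hn.2 hd'.2
    · rintro rfl; exact hn.1 (by simp)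

/-- The linked list that starts in the node `a` holds the events in `l`. The links, the pivots and
the vertices are in the arrays `nx`, `pv` and `vt`; only nodes up to `T` are in use. -/
def EventChain (nx pv vt : ℕ → ℕ) (T : ℕ) : ℕ → List (ℕ × ℕ) → Prop
  | a, [] => a = 0
  | a, e :: es => a ≠ 0 ∧ a ≤ T ∧ pv a = e.1 ∧ vt a = e.2 ∧ EventChain nx pv vt T (nx a) es

theorem EventChain.push {nx pv vt : ℕ → ℕ} {T a b q w : ℕ} {l : List (ℕ × ℕ)}
    (h : EventChain nx pv vt T a l) :
    EventChain (Function.update nx (T + 1) b) (Function.update pv (T + 1) q)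
      (Function.update vt (T + 1) w) (T + 1) a l := by
  induction l generalizing a with
  | nil => exact h
  | cons e l ih =>
    obtain ⟨h₁, h₂, h₃, h₄, h₅⟩ := h
    have : a ≠ T + 1 := by omega
    refine ⟨h₁, by omega, ?_, ?_, ?_⟩
    · rwa [Function.update_of_ne this]
    · rwa [Function.update_of_ne this]
    · rw [Function.update_of_ne this]
      exact ih h₅

/-! ### Partition refinement in one level -/

/-- Appending a pivot `q`, which is at most as large as all the previous ones, leads at most to the
next larger label. -/
theorem append_singleton_le {l l' : List ℕ} {q : ℕ} (h : l < l') (hq : ∀ y ∈ l', q ≤ y)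
    (hd : l'.Pairwise (· > ·)) : l ++ [q] < l' ∨ l ++ [q] = l' := by
  induction l generalizing l' with
  | nil =>
    cases l' with
    | nil => exact absurd h (lt_irrefl _)
    | cons y l' =>
      rcases (hq y (by simp)).lt_or_eq with h' | rfl
      · exact Or.inl (List.cons_lt_cons_iff.2 (Or.inl h'))
      · cases l' with
        | nil => exact Or.inr rfl
        | cons z l' =>
          have h₁ := hq z (by simp)
          have h₂ := (List.pairwise_cons.1 hd).1 z (by simp)
          omega
  | cons x l ih =>
    cases l' with
    | nil => exact absurd h (List.not_lt_nil _)
    | cons y l' =>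
      rcases List.cons_lt_cons_iff.1 h with h' | ⟨rfl, h'⟩
      · exact Or.inl (List.cons_lt_cons_iff.2 (Or.inl h'))
      · rcases ih h' (fun z hz => hq z (by simp [hz])) (List.pairwise_cons.1 hd).2 with h'' | h''
        · exact Or.inl (List.cons_lt_cons_iff.2 (Or.inr ⟨rfl, h''⟩))
        · exact Or.inr (by simp [h''])

theorem lt_append_singleton (l : List ℕ) (q : ℕ) : l < l ++ [q] := by
  induction l with
  | nil => exact List.nil_lt_cons _ _
  | cons x l ih => exact List.cons_lt_cons_iff.2 (Or.inr ⟨rfl, ih⟩)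

/-- The state of the refinement of level `h` after the events in `pre`. The list `cl` holds the
classes, each with the common label of its members, in the order of the linked list; its first
entry is the initial class, which is named `h` and has the empty label. Classes are never removed:
the members of a class can all have moved on. The array `cls` assigns to each vertex its class, and
`pv` to each class the pivot that has created it, the last entry of its label. -/
structure ClassInv (n h : ℕ) (lev : ℕ → ℕ) (pre : List (ℕ × ℕ)) (cls nx pv : ℕ → ℕ) (K : ℕ)
    (cl : List (ℕ × List ℕ)) : Prop where
  root : ∃ tl, cl = (h, []) :: tl
  chain : Linked nx h (cl.map Prod.fst)
  nodup : (cl.map Prod.fst).Nodup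
  sorted : cl.Pairwise fun e e' => e.2 < e'.2
  piv : ∀ e ∈ cl, pv e.1 = e.2.getLastD 0
  id : ∀ e ∈ cl, e.1 = h ∨ n < e.1 ∧ e.1 ≤ K
  closed : ∀ e ∈ cl, e.2 ≠ [] → ∃ c, (c, e.2.dropLast) ∈ cl
  pref : ∀ e ∈ cl, e.2 = [] ∨ ∃ w, w < n ∧ lev w = h ∧ e.2 <+: OrderedGraph.labelOf pre w
  mem : ∀ w, w < n → lev w = h → (cls w, OrderedGraph.labelOf pre w) ∈ cl
  other : ∀ w, w < n → h < lev w → cls w = lev w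
  nx_zero : ∀ c, h < c → c ≤ n → nx c = 0
  pv_zero : ∀ c, c ≤ n → pv c = 0
  length : cl.length ≤ pre.length + 1
  le : n ≤ K

namespace ClassInv

open OrderedGraph

variable {n h : ℕ} {lev : ℕ → ℕ} {pre : List (ℕ × ℕ)} {cls nx pv : ℕ → ℕ} {K : ℕ}
  {cl : List (ℕ × List ℕ)} {q w : ℕ}

theorem label_bounds (hI : ClassInv n h lev pre cls nx pv K cl)
    (hd : Descending (pre ++ [(q, w)])) {e : ℕ × List ℕ} (he : e ∈ cl) :
    (∀ y ∈ e.2, q ≤ y) ∧ e.2.Pairwise (· > ·) := by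
  rcases hI.pref e he with h' | ⟨v, -, -, h'⟩
  · simp [h']
  · obtain ⟨hd₁, -, hd₂⟩ := List.pairwise_append.1 hd
    constructor
    · intro y hy
      exact (hd₂ _ (mem_labelOf.1 (h'.subset hy)) (q, w) (by simp)).1
    · refine List.Pairwise.sublist h'.sublist ?_
      rw [labelOf, List.pairwise_map]
      refine List.Pairwise.imp_of_mem (fun {a b} ha hb hab => ?_) (hd₁.filter _)
      have ha := (List.mem_filter.1 ha).2
      have hb := (List.mem_filter.1 hb).2
      simp only [decide_eq_true_eq] at ha hb
      exact hab.2 (ha.trans hb.symm)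

theorem labelOf_append_event (v : ℕ) : labelOf (pre ++ [(q, w)]) v =
    if w = v then labelOf pre v ++ [q] else labelOf pre v := by
  rw [labelOf_append, labelOf_singleton]
  split_ifs <;> simp

theorem pref_append (hI : ClassInv n h lev pre cls nx pv K cl) {e : ℕ × List ℕ} (he : e ∈ cl) :
    e.2 = [] ∨ ∃ v, v < n ∧ lev v = h ∧ e.2 <+: labelOf (pre ++ [(q, w)]) v := by
  rcases hI.pref e he with h' | ⟨v, h₁, h₂, h₃⟩
  · exact Or.inl h'
  · refine Or.inr ⟨v, h₁, h₂, h₃.trans ?_⟩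
    rw [labelOf_append]
    exact List.prefix_append _ _

/-- If the class after the one of `w` has been created by the pivot `q`, then it has been split off
from the class of `w`. -/
theorem label_next (hI : ClassInv n h lev pre cls nx pv K cl) (hd : Descending (pre ++ [(q, w)]))
    (hq : 1 ≤ q) (hw : w < n) (hwh : lev w = h) (hpv : pv (nx (cls w)) = q) :
    (nx (cls w), labelOf pre w ++ [q]) ∈ cl := by
  obtain ⟨A, B, hcl⟩ := List.append_of_mem (hI.mem w hw hwh)
  have hch := hI.chain
  rw [hcl, List.map_append, List.map_cons] at hch
  have hB := hch.drop
  have hso := hI.sorted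
  rcases B with _ | ⟨⟨d, l'⟩, B⟩
  · have h0 : nx (cls w) = 0 := hB
    rw [h0, hI.pv_zero 0 (by omega)] at hpv
    omega
  · have hd0 : nx (cls w) = d := hB.1
    have hm : (d, l') ∈ cl := by rw [hcl]; simp
    rw [hd0] at hpv ⊢
    have hlast := (hI.piv _ hm).symm.trans hpv
    have hne : l' ≠ [] := by
      rintro rfl
      simp at hlast
      omega
    have hl' : l'.dropLast ++ [q] = l' := by
      rw [← hlast]
      simp only [List.getLastD_eq_getLast?, List.getLast?_eq_some_getLast hne, Option.getD_some]
      exact List.dropLast_append_getLast hne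
    obtain ⟨c', hc'⟩ := hI.closed _ hm hne
    rw [hcl, List.pairwise_append, List.pairwise_cons, List.pairwise_cons] at hso
    obtain ⟨-, ⟨h₁, h₂, -⟩, h₃⟩ := hso
    have hlt : labelOf pre w < l' := h₁ (d, l') (by simp)
    have hbd := hI.label_bounds hd hm
    have hbw := hI.label_bounds hd (hI.mem w hw hwh)
    have hle : l'.dropLast ++ [q] ≤ labelOf pre w ++ [q] := by
      rw [hcl] at hc'
      simp only [List.mem_append, List.mem_cons, Prod.mk.injEq] at hc'
      rcases hc' with hc' | ⟨-, hc'⟩ | ⟨-, hc'⟩ | hc'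
      · have := h₃ _ hc' (cls w, labelOf pre w) (by simp)
        rcases append_singleton_le this hbw.1 hbw.2 with h' | h'
        · exact le_of_lt (h'.trans (lt_append_singleton _ _))
        · exact le_of_lt (h' ▸ lt_append_singleton _ _)
      · exact le_of_eq (by rw [hc'])
      · have := lt_append_singleton l'.dropLast q
        rw [hl'] at this
        exact absurd this (by rw [hc']; exact lt_irrefl _)
      · have h₄ := h₂ _ hc'
        simp only at h₄
        have h₅ := lt_append_singleton l'.dropLast q
        rw [hl'] at h₅
        exact absurd (h₄.trans h₅) (lt_irrefl _)
    rw [hl'] at hle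
    rcases append_singleton_le hlt hbd.1 hbd.2 with h' | h'
    · exact absurd (lt_of_le_of_lt hle h') (lt_irrefl _)
    · rwa [h']

/-- An event that moves its vertex into an existing class. -/
theorem move (hI : ClassInv n h lev pre cls nx pv K cl) (hd : Descending (pre ++ [(q, w)]))
    (hq : 1 ≤ q) (hw : w < n) (hwh : lev w = h) (hpv : pv (nx (cls w)) = q) :
    ClassInv n h lev (pre ++ [(q, w)]) (Function.update cls w (nx (cls w))) nx pv K cl where
  root := hI.root
  chain := hI.chain
  nodup := hI.nodup
  sorted := hI.sorted
  piv := hI.piv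
  id := hI.id
  closed := hI.closed
  pref e he := hI.pref_append he
  mem v hv hvh := by
    rw [labelOf_append_event]
    by_cases e : w = v
    · subst e
      rw [if_pos rfl, Function.update_self]
      exact hI.label_next hd hq hw hwh hpv
    · rw [if_neg e, Function.update_of_ne (Ne.symm e)]
      exact hI.mem v hv hvh
  other v hv hvh := by
    rw [Function.update_of_ne (by rintro rfl; omega)]
    exact hI.other v hv hvh
  nx_zero := hI.nx_zero
  pv_zero := hI.pv_zero
  length := hI.length.trans (by simp)
  le := hI.le

/-- An event that moves its vertex into a new class. -/
theorem split (hI : ClassInv n h lev pre cls nx pv K cl) (hhn : h ≤ n)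
    (hd : Descending (pre ++ [(q, w)]))
    (hw : w < n) (hwh : lev w = h) (hpv : pv (nx (cls w)) ≠ q) :
    ∃ cl', ClassInv n h lev (pre ++ [(q, w)]) (Function.update cls w (K + 1))
      (Function.update (Function.update nx (K + 1) (nx (cls w))) (cls w) (K + 1))
      (Function.update pv (K + 1) q) (K + 1) cl' := by
  have hmw := hI.mem w hw hwh
  obtain ⟨A, B, hcl⟩ := List.append_of_mem hmw
  have hle := hI.le
  have hid : ∀ e ∈ cl, e.1 ≠ K + 1 := fun e he => by
    rcases hI.id e he with h' | h' <;> omega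
  have hmem : ∀ e, e ∈ A ++ (cls w, labelOf pre w) :: (K + 1, labelOf pre w ++ [q]) :: B ↔
      e ∈ cl ∨ e = (K + 1, labelOf pre w ++ [q]) := fun e => by
    rw [hcl]; simp; tauto
  refine ⟨A ++ (cls w, labelOf pre w) :: (K + 1, labelOf pre w ++ [q]) :: B,
    { root := ?_, chain := ?_, nodup := ?_, sorted := ?_, piv := ?_, id := ?_, closed := ?_,
      pref := ?_, mem := ?_, other := ?_, nx_zero := ?_, pv_zero := ?_, length := ?_, le := ?_ }⟩
  · obtain ⟨tl, htl⟩ := hI.root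
    rw [htl] at hcl
    rcases A with _ | ⟨a, A⟩
    · simp only [List.nil_append, List.cons.injEq] at hcl
      exact ⟨_, by rw [List.nil_append, ← hcl.1]⟩
    · simp only [List.cons_append, List.cons.injEq] at hcl
      exact ⟨_, by rw [List.cons_append, ← hcl.1]⟩
  · have h₁ := hI.chain
    have h₂ := hI.nodup
    rw [hcl, List.map_append, List.map_cons] at h₁ h₂
    simp only [List.map_append, List.map_cons]
    refine h₁.insert h₂ (by omega) fun h' => ?_
    rw [← List.map_cons (f := Prod.fst) (a := (cls w, labelOf pre w)), ← List.map_append,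
      ← hcl] at h'
    obtain ⟨e, he, he'⟩ := List.mem_map.1 h'
    exact hid e he he'
  · have h₂ := hI.nodup
    have h₃ : K + 1 ∉ cl.map Prod.fst := fun h' => by
      obtain ⟨e, he, he'⟩ := List.mem_map.1 h'
      exact hid e he he'
    have hp : List.Perm (A ++ (cls w, labelOf pre w) :: (K + 1, labelOf pre w ++ [q]) :: B)
        ((K + 1, labelOf pre w ++ [q]) :: cl) := by
      rw [hcl]
      exact ((List.Perm.swap _ _ _).append_left A).trans List.perm_middle
    rw [(hp.map _).nodup_iff]
    exact List.nodup_cons.2 ⟨h₃, h₂⟩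
  · have hso := hI.sorted
    rw [hcl, List.pairwise_append, List.pairwise_cons] at hso
    obtain ⟨s₁, ⟨s₂, s₃⟩, s₄⟩ := hso
    have hnew : ∀ e ∈ B, labelOf pre w ++ [q] < e.2 := by
      rcases B with _ | ⟨⟨d, l'⟩, B⟩
      · simp
      · have hm : (d, l') ∈ cl := by rw [hcl]; simp
        have hch := hI.chain
        rw [hcl, List.map_append, List.map_cons] at hch
        have hd0 : nx (cls w) = d := hch.drop.1
        have hbd := hI.label_bounds hd hm
        have hlt : labelOf pre w ++ [q] < l' := by
          rcases append_singleton_le (s₂ (d, l') (by simp)) hbd.1 hbd.2 with h' | h'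
          · exact h'
          · exfalso
            apply hpv
            rw [hd0, hI.piv _ hm, ← h']
            simp
        intro e he
        rcases List.mem_cons.1 he with rfl | he
        · exact hlt
        · exact hlt.trans ((List.pairwise_cons.1 s₃).1 e he)
    refine List.pairwise_append.2 ⟨s₁, List.pairwise_cons.2 ⟨?_, List.pairwise_cons.2
      ⟨hnew, s₃⟩⟩, ?_⟩
    · intro e he
      rcases List.mem_cons.1 he with rfl | he
      · exact lt_append_singleton _ _
      · exact s₂ e he
    · intro a ha b hb
      simp only [List.mem_cons] at hb
      have h₀ := s₄ a ha (cls w, labelOf pre w) (by simp)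
      rcases hb with rfl | rfl | hb
      · exact h₀
      · exact lt_trans h₀ (lt_append_singleton _ _)
      · exact s₄ a ha b (by simp [hb])
  · intro e he
    rcases (hmem e).1 he with he | rfl
    · rw [Function.update_of_ne (hid e he)]
      exact hI.piv e he
    · simp
  · intro e he
    rcases (hmem e).1 he with he | rfl
    · rcases hI.id e he with h' | h'
      · exact Or.inl h'
      · exact Or.inr ⟨h'.1, by omega⟩
    · exact Or.inr ⟨by simp; omega, le_rfl⟩
  · intro e he hne
    rcases (hmem e).1 he with he | rfl
    · obtain ⟨c, hc⟩ := hI.closed e he hne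
      exact ⟨c, (hmem _).2 (Or.inl hc)⟩
    · exact ⟨cls w, (hmem _).2 (Or.inl (by simpa using hmw))⟩
  · intro e he
    rcases (hmem e).1 he with he | rfl
    · exact hI.pref_append he
    · refine Or.inr ⟨w, hw, hwh, ?_⟩
      rw [labelOf_append_event, if_pos rfl]
  · intro v hv hvh
    rw [labelOf_append_event, hmem]
    by_cases e : w = v
    · subst e
      rw [if_pos rfl, Function.update_self]
      exact Or.inr rfl
    · rw [if_neg e, Function.update_of_ne (Ne.symm e)]
      exact Or.inl (hI.mem v hv hvh)
  · intro v hv hvh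
    rw [Function.update_of_ne (by rintro rfl; omega)]
    exact hI.other v hv hvh
  · intro c hc hcn
    have : c ≠ cls w := by
      rintro rfl
      rcases hI.id _ hmw with h' | h' <;> simp only at h' <;> omega
    rw [Function.update_of_ne this, Function.update_of_ne (by omega)]
    exact hI.nx_zero c hc hcn
  · intro c hcn
    rw [Function.update_of_ne (by omega)]
    exact hI.pv_zero c hcn
  · have := hI.length
    rw [hcl] at this
    simp at this ⊢
    omega
  · omega

end ClassInv

namespace OrderedGraph

variable {D : OrderedGraph} {lev t : ℕ → ℕ}

/-- The events at the vertices of level `h`. -/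
def levelEvents (lev : ℕ → ℕ) (l : List (ℕ × ℕ)) (h : ℕ) : List (ℕ × ℕ) :=
  l.filter fun e => lev e.2 = h

theorem labelOf_levelEvents {l : List (ℕ × ℕ)} {h w : ℕ} (hw : lev w = h) :
    labelOf (levelEvents lev l h) w = labelOf l w := by
  rw [labelOf, labelOf, levelEvents, List.filter_filter]
  congr 1
  refine List.filter_congr fun e _ => ?_
  by_cases h' : e.2 = w <;> simp [h', hw]

/-- The vertices of the final classes, those which are created by tie-breaking events, in the order
of the class list. -/
def finalVertices (D : OrderedGraph) (cl : List (ℕ × List ℕ)) : List ℕ :=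
  (cl.filter fun e => e.2.getLastD 0 ≤ D.n).map fun e => D.π (e.2.getLastD 0 - 1)

/-- At the end of the refinement of level `h`, each vertex is in a final class of its own. -/
theorem finalVertices_spec {h p : ℕ} {cls nx pv : ℕ → ℕ} {K : ℕ} {cl : List (ℕ × List ℕ)}
    (ht : ∀ k, k < p → t k < D.n)
    (hI : ClassInv D.n h lev (levelEvents lev (D.events t p) h) cls nx pv K ((h, []) :: cl)) :
    (∀ v, v ∈ D.finalVertices cl ↔ v < D.n ∧ lev v = h) ∧
      (D.finalVertices cl).Pairwise
        fun v w => labelOf (D.events t p) v < labelOf (D.events t p) w := by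
  have hso := List.pairwise_cons.1 hI.sorted
  have key : ∀ e ∈ cl, e.2.getLastD 0 ≤ D.n → D.π (e.2.getLastD 0 - 1) < D.n ∧
      lev (D.π (e.2.getLastD 0 - 1)) = h ∧
      e.2 = labelOf (D.events t p) (D.π (e.2.getLastD 0 - 1)) := by
    intro e he hle
    have hne : e.2 ≠ [] := fun h' => by
      have := hso.1 e he
      rw [h'] at this
      exact absurd this (List.not_lt_nil _)
    rcases hI.pref e (by simp [he]) with h' | ⟨w, hw, hwh, hpre⟩
    · exact absurd h' hne
    rw [labelOf_levelEvents hwh] at hpre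
    have hlm : e.2.getLastD 0 ∈ e.2 := by
      simp only [List.getLastD_eq_getLast?, List.getLast?_eq_some_getLast hne, Option.getD_some]
      exact List.getLast_mem hne
    have hev := mem_events.1 (mem_labelOf.1 (hpre.subset hlm))
    rcases hev with ⟨-, -, rfl⟩ | ⟨k, -, hk, -⟩
    · refine ⟨hw, hwh, ?_⟩
      rw [labelOf_events hw ht] at hpre ⊢
      rcases List.prefix_concat_iff.1 hpre with h' | h'
      · exact h'
      · obtain ⟨a, ha, ha'⟩ := List.mem_map.1 (h'.subset hlm)
        have := pos_of_mem_lbl ha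
        omega
    · omega
  constructor
  · intro v
    simp only [finalVertices, List.mem_map, List.mem_filter, decide_eq_true_eq]
    constructor
    · rintro ⟨e, ⟨he, hle⟩, rfl⟩
      exact ⟨(key e he hle).1, (key e he hle).2.1⟩
    · rintro ⟨hv, hvh⟩
      have hm := hI.mem v hv hvh
      rw [labelOf_levelEvents hvh, labelOf_events hv ht] at hm
      have := D.pos_lt v hv
      refine ⟨_, ⟨(List.mem_cons.1 hm).resolve_left (by simp), ?_⟩, ?_⟩
      · simp; omega
      · simp [D.π_pos v hv]
  · rw [finalVertices, List.pairwise_map]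
    refine List.Pairwise.imp_of_mem (fun {a b} ha hb hab => ?_) (hso.2.filter _)
    have ha := List.mem_filter.1 ha
    have hb := List.mem_filter.1 hb
    simp only [decide_eq_true_eq] at ha hb
    rwa [← (key a ha.1 ha.2).2.2, ← (key b hb.1 hb.2).2.2]

end OrderedGraph

/-! ### Heights, one vertex at a time -/

namespace OrderedGraph

variable {D : OrderedGraph}

/-- The total length of the adjacency lists, twice the number of edges. -/
def size (D : OrderedGraph) : ℕ := ∑ v ∈ Finset.range D.n, (D.N v).length

theorem sum_π (D : OrderedGraph) (f : ℕ → ℕ) :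
    ∑ i ∈ Finset.range D.n, f (D.π i) = ∑ v ∈ Finset.range D.n, f v :=
  Finset.sum_nbij' D.π D.pos (fun i hi => by simpa using D.π_lt i (by simpa using hi))
    (fun v hv => by simpa using D.pos_lt v (by simpa using hv))
    (fun i hi => D.pos_π i (by simpa using hi)) (fun v hv => D.π_pos v (by simpa using hv))
    fun _ _ => rfl

theorem length_lt {v : ℕ} (hv : v < D.n) : (D.N v).length < D.n := by
  rw [← List.toFinset_card_of_nodup (D.nodup v hv), ← Finset.card_range D.n]
  refine Finset.card_lt_card ⟨fun u hu => ?_, fun h => ?_⟩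
  · simpa using D.lt v hv u (by simpa using hu)
  · exact D.irrefl v hv (by simpa using h (by simpa using hv : v ∈ Finset.range D.n))

/-- The heights of the vertices in the positions `i, …, n - 1` are known and stored in `lev`. The
largest one is `M`, and `cnt k` is the number of vertices of height `k`; the value of `cnt 0` stops
the search for the height of the next vertex. -/
structure LevelInv (D : OrderedGraph) (i : ℕ) (lev cnt : ℕ → ℕ) (M : ℕ) : Prop where
  zero : ∀ v, v < D.n → D.pos v < i → lev v = 0
  pos : ∀ v, v < D.n → i ≤ D.pos v → 1 ≤ lev v
  le : ∀ v, v < D.n → lev v ≤ M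
  lt : ∀ u, u < D.n → ∀ w, w < D.n → i ≤ D.pos w → D.Below u w → lev u < lev w
  pred : ∀ w, w < D.n → i ≤ D.pos w → 2 ≤ lev w → ∃ u, u < D.n ∧ D.Below u w ∧ lev u + 1 = lev w
  cnt_zero : cnt 0 = D.n
  cnt_eq : ∀ k, 1 ≤ k → cnt k = ((Finset.range D.n).filter fun v => lev v = k).card
  add_le : M + i ≤ D.n
  nonempty : ∀ k, 1 ≤ k → k ≤ M → ∃ v, v < D.n ∧ lev v = k

theorem LevelInv.isLevel {lev cnt : ℕ → ℕ} {M : ℕ} (h : D.LevelInv 0 lev cnt M) :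
    D.IsLevel lev where
  pos v hv := h.pos v hv (Nat.zero_le _)
  lt u hu w hw := h.lt u hu w hw (Nat.zero_le _)
  pred w hw := h.pred w hw (Nat.zero_le _)

section Step

variable {i : ℕ} {lev cnt nb : ℕ → ℕ} {M k : ℕ}

theorem LevelInv.mem_of_eq (h : D.LevelInv (i + 1) lev cnt M) {w : ℕ} (hw : w < D.n)
    (hnb : ∀ k, nb k = (D.N w).countP fun u => lev u = k) (hk : 1 ≤ k) :
    nb k = cnt k ↔ ∀ v, v < D.n → lev v = k → v ∈ D.N w := by
  have h₁ : nb k = ((D.N w).toFinset.filter fun v => lev v = k).card := by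
    rw [hnb, List.countP_eq_length_filter, ← List.toFinset_card_of_nodup ((D.nodup w hw).filter _),
      List.toFinset_filter]
    simp
  have h₂ : ((D.N w).toFinset.filter fun v => lev v = k) ⊆
      (Finset.range D.n).filter fun v => lev v = k := by
    intro v hv
    simp only [Finset.mem_filter, List.mem_toFinset, Finset.mem_range] at hv ⊢
    exact ⟨D.lt w hw v hv.1, hv.2⟩
  rw [h₁, h.cnt_eq k hk]
  constructor
  · intro he v hv hvk
    have := Finset.eq_of_subset_of_card_le h₂ he.ge
    have hv' : v ∈ (Finset.range D.n).filter fun v => lev v = k := by simp [hv, hvk]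
    rw [← this] at hv'
    simpa using (Finset.mem_filter.1 hv').1
  · intro h'
    congr 1
    refine h₂.antisymm fun v hv => ?_
    simp only [Finset.mem_filter, List.mem_toFinset, Finset.mem_range] at hv ⊢
    exact ⟨h' v hv.1 hv.2, hv.2⟩

/-- The search for the height of `w` ends, and it takes at most one step per neighbour, since each
level that is skipped contains one. -/
theorem LevelInv.exists_top (h : D.LevelInv (i + 1) lev cnt M) {w : ℕ} (hw : w < D.n)
    (hnb : ∀ k, nb k = (D.N w).countP fun u => lev u = k) :
    ∃ k, k ≤ M ∧ nb k ≠ cnt k ∧ (∀ k', k < k' → k' ≤ M → nb k' = cnt k') ∧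
      M - k ≤ (D.N w).length := by
  have h0 : nb 0 ≠ cnt 0 := by
    have h₁ := List.countP_le_length (l := D.N w) (p := fun u => decide (lev u = 0))
    have h₂ := length_lt hw
    rw [h.cnt_zero, hnb]
    omega
  have hg := Nat.findGreatest_spec (P := fun k => nb k ≠ cnt k) (Nat.zero_le M) h0
  have hgt : ∀ k', Nat.findGreatest (fun k => nb k ≠ cnt k) M < k' → k' ≤ M → nb k' = cnt k' :=
    fun k' h₁ h₂ => by
      by_contra hne
      exact Nat.findGreatest_is_greatest h₁ h₂ hne
  refine ⟨_, Nat.findGreatest_le M, hg, hgt, ?_⟩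
  rw [← Nat.card_Ioc]
  refine le_trans (Finset.card_le_card (t := (D.N w).toFinset.image lev) fun k hk => ?_)
    (Finset.card_image_le.trans (List.toFinset_card_le _))
  rw [Finset.mem_Ioc] at hk
  obtain ⟨v, hv, hvk⟩ := h.nonempty k (by omega) hk.2
  rw [Finset.mem_image]
  exact ⟨v, by simpa using (h.mem_of_eq hw hnb (by omega)).1 (hgt k hk.1 hk.2) v hv hvk, hvk⟩

theorem LevelInv.step (h : D.LevelInv (i + 1) lev cnt M) (hi : i < D.n)
    (hnb : ∀ k, nb k = (D.N (D.π i)).countP fun u => lev u = k)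
    (hkM : k ≤ M) (hk : nb k ≠ cnt k) (hk' : ∀ k', k < k' → k' ≤ M → nb k' = cnt k') :
    D.LevelInv i (Function.update lev (D.π i) (k + 1))
      (Function.update cnt (k + 1) (cnt (k + 1) + 1)) (max M (k + 1)) := by
  have hw := D.π_lt i hi
  have hpw := D.pos_π i hi
  have hlw : lev (D.π i) = 0 := h.zero _ hw (by omega)
  have hne : ∀ v, v < D.n → D.pos v ≠ i → v ≠ D.π i := by
    rintro v hv h' rfl
    exact h' hpw
  have hpos : ∀ v, v < D.n → v ≠ D.π i → D.pos v ≠ i := by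
    rintro v hv h' rfl
    exact h' (D.π_pos v hv).symm
  refine ⟨?_, ?_, ?_, ?_, ?_, ?_, ?_, ?_, ?_⟩
  · intro v hv hvi
    rw [Function.update_of_ne (hne v hv (by omega))]
    exact h.zero v hv (by omega)
  · intro v hv hvi
    by_cases e : v = D.π i
    · subst e; simp
    · have := hpos v hv e
      rw [Function.update_of_ne e]
      exact h.pos v hv (by omega)
  · intro v hv
    by_cases e : v = D.π i
    · subst e; simp
    · rw [Function.update_of_ne e]
      exact (h.le v hv).trans (le_max_left _ _)
  · intro u hu w hw' hiw hb
    have hbp := hb.1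
    rw [Function.update_of_ne (hne u hu (by omega))]
    by_cases e : w = D.π i
    · subst e
      rw [Function.update_self, Nat.lt_succ_iff]
      by_contra hlt
      have := (h.mem_of_eq hw hnb (by omega)).1 (hk' (lev u) (by omega) (h.le u hu)) u hu rfl
      exact hb.2 (D.symm _ hw u hu this)
    · have := hpos w hw' e
      rw [Function.update_of_ne e]
      exact h.lt u hu w hw' (by omega) hb
  · intro w hw' hiw h2
    by_cases e : w = D.π i
    · subst e
      rw [Function.update_self] at h2 ⊢
      have hk1 : 1 ≤ k := by omega
      have := mt (h.mem_of_eq hw hnb hk1).2 hk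
      push Not at this
      obtain ⟨u, hu, hul, hun⟩ := this
      have hup : i + 1 ≤ D.pos u := by
        by_contra hlt
        have := h.zero u hu (by omega)
        omega
      refine ⟨u, hu, ⟨by omega, fun h' => hun (D.symm u hu _ hw h')⟩, ?_⟩
      rw [Function.update_of_ne (hne u hu (by omega)), hul]
    · have := hpos w hw' e
      rw [Function.update_of_ne e] at h2 ⊢
      obtain ⟨u, hu, hb, hul⟩ := h.pred w hw' (by omega) h2
      have hbp := hb.1
      exact ⟨u, hu, hb, by rwa [Function.update_of_ne (hne u hu (by omega))]⟩
  · rw [Function.update_of_ne (by omega)]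
    exact h.cnt_zero
  · intro l hl
    by_cases e : l = k + 1
    · subst e
      rw [Function.update_self, h.cnt_eq _ hl]
      have : ((Finset.range D.n).filter fun v => Function.update lev (D.π i) (k + 1) v = k + 1) =
          insert (D.π i) ((Finset.range D.n).filter fun v => lev v = k + 1) := by
        ext v
        by_cases e : v = D.π i
        · subst e; simp [hw]
        · simp [e]
      rw [this, Finset.card_insert_of_notMem (by simp [hlw])]
    · rw [Function.update_of_ne e, h.cnt_eq _ hl]
      congr 1
      refine Finset.filter_congr fun v _ => ?_
      by_cases e' : v = D.π i
      · subst e'; rw [Function.update_self, hlw]; omega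
      · rw [Function.update_of_ne e']
  · have := h.add_le
    omega
  · intro l hl hlM
    by_cases e : l = k + 1
    · exact ⟨D.π i, hw, by simp [e]⟩
    · obtain ⟨v, hv, hvl⟩ := h.nonempty l hl (by omega)
      refine ⟨v, hv, ?_⟩
      rw [Function.update_of_ne, hvl]
      rintro rfl
      omega

end Step

end OrderedGraph

/-! ### The program -/

attribute [local simp] wp_skip wp_assign wp_write wp_seq wp_cond Operation.val Operand.val
  Test.holds

@[simp] theorem Store.reg_setReg (s : Store) (x v : ℕ) :
    (s.setReg x v).reg = Function.update s.reg x v := rfl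

@[simp] theorem Store.arr_setReg (s : Store) (x v : ℕ) : (s.setReg x v).arr = s.arr := rfl

@[simp] theorem Store.reg_setCell (s : Store) (A i v : ℕ) : (s.setCell A i v).reg = s.reg := rfl

@[simp] theorem Store.arr_setCell (s : Store) (A i v : ℕ) :
    (s.setCell A i v).arr = Function.update s.arr A (Function.update (s.arr A) i v) := rfl

theorem wp_frame {W t : ℕ} {s : Store} {P : Program} {Q : ℕ → Store → Prop}
    (h : wp W P (fun t' s' => Frame P s s' → Q t' s') t s) : wp W P Q t s := by
  obtain ⟨t', s', h, hQ⟩ := h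
  exact ⟨t', s', h, hQ h.frame⟩

local infixr:65 " ;; " => Program.seq

/-! The registers of the program: `rN` is the number of vertices; `rI`, `rM`, `rK`, `rX`, `rY` serve
the computation of the heights, where `rM` is the largest height so far; `rW`, `rA`, `rB`, `rU`,
`rL` serve the scan of the adjacency list of `rW`, with `rU` the current neighbour and `rL` its
height; `rT` is the number of events, `rE` the node of an event and `rQ` a pivot; `rH` is the
current level, `rOff` and `rEnd` bound a range of positions of the output, and `rP` is one of them;
`rC` and `rD` are classes, and `rZ` is the largest class in use. -/

local notation "rN" => (0 : ℕ)
local notation "rI" => (1 : ℕ)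
local notation "rM" => (2 : ℕ)
local notation "rW" => (3 : ℕ)
local notation "rA" => (4 : ℕ)
local notation "rB" => (5 : ℕ)
local notation "rU" => (6 : ℕ)
local notation "rL" => (7 : ℕ)
local notation "rX" => (8 : ℕ)
local notation "rY" => (9 : ℕ)
local notation "rK" => (10 : ℕ)
local notation "rT" => (11 : ℕ)
local notation "rE" => (12 : ℕ)
local notation "rQ" => (13 : ℕ)
local notation "rOff" => (14 : ℕ)
local notation "rEnd" => (15 : ℕ)
local notation "rH" => (16 : ℕ)
local notation "rP" => (17 : ℕ)
local notation "rC" => (18 : ℕ)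
local notation "rD" => (19 : ℕ)
local notation "rZ" => (20 : ℕ)

/-! The arrays: input (`aStart`, `aAdj`, `aOrder`) and output (`aOut`); the height of a vertex
(`aLev`), the number of vertices on a level (`aCnt`) and the number of neighbours on a level
(`aNb`); the class of a vertex (`aCls`), the next class (`aNext`) and the pivot that created a class
(`aPiv`); the first event of a level (`aEvHead`), the next event (`aEvNext`), and the pivot and the
vertex of an event (`aEvPiv`, `aEvVert`). -/

local notation "aStart" => (0 : ℕ)
local notation "aAdj" => (1 : ℕ)
local notation "aOrder" => (2 : ℕ)
local notation "aOut" => (3 : ℕ)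
local notation "aLev" => (4 : ℕ)
local notation "aCnt" => (5 : ℕ)
local notation "aNb" => (6 : ℕ)
local notation "aCls" => (7 : ℕ)
local notation "aNext" => (8 : ℕ)
local notation "aPiv" => (9 : ℕ)
local notation "aEvHead" => (10 : ℕ)
local notation "aEvNext" => (11 : ℕ)
local notation "aEvPiv" => (12 : ℕ)
local notation "aEvVert" => (13 : ℕ)

/-- The input part of the store describes the ordered graph `D`. -/
structure OrderedGraph.Holds (D : OrderedGraph) (s : Store) : Prop where
  size : s.reg rN = D.n
  start : ∀ v, v ≤ D.n → s.arr aStart v = ∑ u ∈ Finset.range v, (D.N u).length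
  adj : ∀ v, v < D.n → ∀ (k : ℕ) (hk : k < (D.N v).length),
    s.arr aAdj (s.arr aStart v + k) = (D.N v)[k]
  order : ∀ i, i < D.n → s.arr aOrder i = D.π i

theorem OrderedGraph.Holds.congr {D : OrderedGraph} {s s' : Store} (h : D.Holds s)
    (h₀ : s'.reg rN = s.reg rN) (h₁ : s'.arr aStart = s.arr aStart) (h₂ : s'.arr aAdj = s.arr aAdj)
    (h₃ : s'.arr aOrder = s.arr aOrder) : D.Holds s' := by
  refine ⟨by rw [h₀, h.size], by rw [h₁]; exact h.start, ?_, by rw [h₃]; exact h.order⟩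
  rw [h₁, h₂]
  exact h.adj

/-- Run `body` for each vertex `rU` in the adjacency list of the vertex `rW`. -/
def scan (body : Program) : Program :=
  .assign rA (.read aStart (.reg rW)) ;;
  .assign rB (.add (.reg rW) (.lit 1)) ;;
  .assign rB (.read aStart (.reg rB)) ;;
  .loop (.lt (.reg rA) (.reg rB))
    (.assign rU (.read aAdj (.reg rA)) ;; body ;; .assign rA (.add (.reg rA) (.lit 1)))

/-- The part of the store that `scan` needs is not written to by the body. -/
def ScanBody (body : Program) : Prop :=
  body.setsReg rA = false ∧ body.setsReg rB = false ∧ body.setsReg rW = false ∧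
    body.setsArr aStart = false ∧ body.setsArr aAdj = false

theorem OrderedGraph.start_le {D : OrderedGraph} {v : ℕ} (hv : v ≤ D.n) :
    ∑ u ∈ Finset.range v, (D.N u).length ≤ D.size :=
  Finset.sum_le_sum_of_subset (by simpa using hv)

/-- The rule for `scan`, with an invariant `I k` for the state after `k` neighbours that does not
depend on the registers that `scan` itself uses. -/
theorem wp_scan {D : OrderedGraph} {W t w c : ℕ} {s : Store} {Q : ℕ → Store → Prop}
    {body : Program} (hD : D.Holds s) (hW : D.n + D.size + 1 ≤ W) (hbody : ScanBody body)
    (hw : s.reg rW = w) (hwn : w < D.n) (I : ℕ → Store → Prop)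
    (hI : ∀ k s x v, x = rA ∨ x = rB ∨ x = rU → I k s → I k (s.setReg x v))
    (init : I 0 s)
    (step : ∀ k s' (hk : k < (D.N w).length), Frame (scan body) s s' → I k s' →
      s'.reg rU = (D.N w)[k] → wp W body (fun t' s'' => t' ≤ c ∧ I (k + 1) s'') 0 s')
    (post : ∀ t' s', t' ≤ t + 4 + (D.N w).length * (c + 3) → Frame (scan body) s s' →
      I (D.N w).length s' → Q t' s') : wp W (scan body) Q t s := by
  have hst := hD.start w hwn.le
  have hst' := hD.start (w + 1) hwn
  have hle := OrderedGraph.start_le (D := D) hwn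
  rw [Finset.sum_range_succ, ← hst] at hst' hle
  obtain ⟨b₁, b₂, b₃, b₄, b₅⟩ := hbody
  apply wp_frame
  rw [scan]
  simp only [wp_seq, wp_assign, Operation.val, Operand.val, Store.reg_setReg, Store.arr_setReg,
    Function.update_self, Function.update_of_ne, hw, hst', ne_eq, 
    Nat.reduceEqDiff, not_false_eq_true]
  refine ⟨by omega, by omega, by omega, ?_⟩
  refine wp_loop (fun k s' => I k s' ∧ s'.reg rA = s.arr aStart w + k ∧
      s'.reg rB = s.arr aStart w + (D.N w).length ∧ s'.arr aStart = s.arr aStart ∧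
      s'.arr aAdj = s.arr aAdj ∧ Frame (scan body) s s')
    (D.N w).length (fun _ => c + 2) ?_ ?_ ?_ ?_
  · refine ⟨?_, by simp, by simp, by simp, by simp, ?_⟩
    · exact hI _ _ _ _ (by simp) (hI _ _ _ _ (by simp) (hI _ _ _ _ (by simp) init))
    · refine ⟨fun x hx => ?_, fun A _ => by simp⟩
      simp [scan, Program.setsReg] at hx
      simp [hx]
  · rintro k s' hk - ⟨hIk, hA, hB, h0, h1, hf⟩
    have hr : s'.arr aAdj (s'.reg rA) = (D.N w)[k] := by rw [h1, hA, hD.adj w hwn]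
    have hlt := D.lt w hwn _ (List.getElem_mem hk)
    refine ⟨by simp; omega, ?_⟩
    simp only [wp_seq, wp_assign, Operation.val, Operand.val, hr]
    refine ⟨by omega, ?_⟩
    have hf' : Frame (scan body) s (s'.setReg rU (D.N w)[k]) := by
      refine ⟨fun x hx => ?_, fun A hA => by simpa using hf.arr A hA⟩
      have := hf.reg x hx
      simp [scan, Program.setsReg] at hx
      simp [hx, this]
    obtain ⟨t', s'', he, ht', hI'⟩ := step k (s'.setReg rU (D.N w)[k]) hk hf'
      (hI _ _ _ _ (by simp) hIk) (by simp)
    have hfr := he.frame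
    have e4 := hfr.reg rA b₁
    have e5 := hfr.reg rB b₂
    simp only [Store.reg_setReg, ne_eq, Nat.reduceEqDiff,
      not_false_eq_true, Function.update_of_ne] at e4 e5
    refine ⟨t', s'', he, wp_assign.2 ⟨?_, ?_, ?_⟩⟩
    · simp [e4, hA]; omega
    · omega
    · refine ⟨hI _ _ _ _ (by simp) hI', ?_, ?_, ?_, ?_, ?_⟩
      · simp [e4, hA]; omega
      · simp [e5, hB]
      · simp [hfr.arr aStart b₄, h0]
      · simp [hfr.arr aAdj b₅, h1]
      · refine ⟨fun x hx => ?_, fun A hA => ?_⟩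
        · have h₁ := hf'.reg x hx
          simp [scan, Program.setsReg] at hx
          have h₂ := hfr.reg x (by simp [hx])
          simp [hx] at h₁ h₂ ⊢
          rw [h₂, h₁]
        · have h₁ := hf'.arr A hA
          simp [scan, Program.setsArr] at hA
          have h₂ := hfr.arr A hA
          simp at h₁ h₂ ⊢
          rw [h₂, h₁]
  · rintro s' - ⟨-, hA, hB, -⟩
    simp [hA, hB]
  · rintro t' s' ht' - ⟨hI', -, -, -, -, hf⟩ -
    refine post t' s' ?_ hf hI'
    simp at ht'
    linarith

/-- Compute the height of the vertex in position `rI - 1`: count its neighbours on each level,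
search downwards from the largest height for a level with a vertex that is not a neighbour, and reset the
counters. -/
def levelBody : Program :=
  .assign rI (.sub (.reg rI) (.lit 1)) ;;
  .assign rW (.read aOrder (.reg rI)) ;;
  scan (.assign rL (.read aLev (.reg rU)) ;;
    .assign rX (.read aNb (.reg rL)) ;;
    .assign rX (.add (.reg rX) (.lit 1)) ;;
    .write aNb (.reg rL) (.reg rX)) ;;
  .assign rK (.copy (.reg rM)) ;;
  .assign rX (.read aNb (.reg rK)) ;;
  .assign rY (.read aCnt (.reg rK)) ;;
  .loop (.eq (.reg rX) (.reg rY))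
    (.assign rK (.sub (.reg rK) (.lit 1)) ;;
    .assign rX (.read aNb (.reg rK)) ;;
    .assign rY (.read aCnt (.reg rK))) ;;
  .assign rK (.add (.reg rK) (.lit 1)) ;;
  .write aLev (.reg rW) (.reg rK) ;;
  .write aCls (.reg rW) (.reg rK) ;;
  .assign rX (.read aCnt (.reg rK)) ;;
  .assign rX (.add (.reg rX) (.lit 1)) ;;
  .write aCnt (.reg rK) (.reg rX) ;;
  .cond (.lt (.reg rM) (.reg rK)) (.assign rM (.copy (.reg rK))) .skip ;;
  scan (.assign rL (.read aLev (.reg rU)) ;; .write aNb (.reg rL) (.lit 0))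

/-- Compute the heights of all vertices, from the last one in the ordering to the first one. The
cell `0` of `aCnt` is set to `n`, more than the number of neighbours of any vertex, to stop the search at
the height `0`. -/
def levelPhase : Program :=
  .write aCnt (.lit 0) (.reg rN) ;;
  .assign rI (.copy (.reg rN)) ;;
  .loop (.lt (.lit 0) (.reg rI)) levelBody

/-- One iteration of `levelPhase` computes the height of the vertex in position `i`, in time
proportional to its degree. -/
theorem wp_levelBody {D : OrderedGraph} {W i : ℕ} {s : Store} (hD : D.Holds s)
    (hW : 2 * D.n + D.size + 1 ≤ W) (hi : i < D.n) (hI : s.reg rI = i + 1)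
    (hL : D.LevelInv (i + 1) (s.arr aLev) (s.arr aCnt) (s.reg rM)) (hnb : ∀ l, s.arr aNb l = 0)
    (hcls : ∀ v, v < D.n → s.arr aCls v = s.arr aLev v) :
    wp W levelBody (fun t' s' => t' ≤ 30 + 16 * (D.N (D.π i)).length ∧ s'.reg rI = i ∧
      D.LevelInv i (s'.arr aLev) (s'.arr aCnt) (s'.reg rM) ∧ (∀ l, s'.arr aNb l = 0) ∧
      ∀ v, v < D.n → s'.arr aCls v = s'.arr aLev v) 0 s := by
  have hw := D.π_lt i hi
  have hord := hD.order i hi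
  have hMn := hL.add_le
  set w := D.π i with hwdef
  have hdeg := OrderedGraph.length_lt hw
  have hlevle : ∀ v, v < D.n → s.arr aLev v ≤ D.n := fun v hv => (hL.le v hv).trans (by omega)
  unfold levelBody
  simp only [wp_seq, wp_assign, Operation.val, Operand.val, Store.reg_setReg, Store.arr_setReg,
    Function.update_self, hI, Nat.add_sub_cancel, hord]
  refine ⟨by omega, by omega, ?_⟩
  -- The first scan counts the neighbours on each level; unprocessed ones count as height `0`.
  refine wp_scan (D := D) (w := w) (c := 4) (hD.congr (by simp) rfl rfl rfl) (by omega) ?_ (by simp)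
    hw (fun k s' => ∀ l, s'.arr aNb l = ((D.N w).take k).countP fun u => s.arr aLev u = l)
    (fun k s x v _ h => h) (by simpa using hnb) ?_ ?_
  · simp [ScanBody, Program.setsReg, Program.setsArr]
  · intro k s' hk hf hIk hu
    have h4 := hf.arr aLev rfl
    simp only [Store.arr_setReg] at h4
    have hun := D.lt w hw _ (List.getElem_mem hk)
    have hle := hlevle _ hun
    have hcl := List.countP_le_length (l := (D.N w).take k)
      (p := fun u => decide (s.arr aLev u = s.arr aLev (D.N w)[k]))
    rw [List.length_take] at hcl
    simp only [wp_seq, wp_assign, wp_write, Operation.val, Operand.val, Store.reg_setReg,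
      Store.arr_setReg, Function.update_self, hu, h4, hIk, Store.arr_setCell]
    refine ⟨by omega, by omega, by omega, ?_, by omega, fun l => ?_⟩
    · simp; omega
    · rw [List.take_succ_eq_append_getElem hk, List.countP_append]
      by_cases e : l = s.arr aLev (D.N w)[k]
      · subst e; simp
      · simp [Function.update_of_ne e, hIk, Ne.symm e]
  intro t₁ s₁ ht₁ hf₁ hnb₁
  rw [List.take_length] at hnb₁
  have f1 := hf₁.reg rM rfl
  have f2 := hf₁.reg rW rfl
  have f3 := hf₁.reg rI rfl
  have f4 := hf₁.arr aLev rfl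
  have f5 := hf₁.arr aCnt rfl
  have f6 := hf₁.arr aCls rfl
  have f7 := hf₁.reg rN rfl
  have f8 := hf₁.arr aStart rfl
  have f9 := hf₁.arr aAdj rfl
  have f10 := hf₁.arr aOrder rfl
  simp at f1 f2 f3 f4 f5 f6 f7 f8 f9 f10
  have hcle : ∀ k, s.arr aCnt k ≤ D.n := by
    intro k
    rcases Nat.eq_zero_or_pos k with rfl | hk
    · rw [hL.cnt_zero]
    · rw [hL.cnt_eq k hk]
      exact (Finset.card_filter_le _ _).trans (by simp)
  have hnle : ∀ k, s₁.arr aNb k ≤ D.n := fun k => by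
    rw [hnb₁]
    exact List.countP_le_length.trans hdeg.le
  have hcW : ∀ k, s.arr aCnt k ≤ W := fun k => (hcle k).trans (by omega)
  have hnW : ∀ k, s₁.arr aNb k ≤ W := fun k => (hnle k).trans (by omega)
  obtain ⟨kf, hkM, hk, hk', hkd⟩ := hL.exists_top hw hnb₁
  simp only [wp_seq, wp_assign, Operation.val, Operand.val, Store.reg_setReg, Store.arr_setReg,
    Function.update_self, f1]
  refine ⟨by omega, hnW _, by simpa [f5] using hcW _, ?_⟩
  -- The search goes down from the largest height to the first level `kf` that is not full.
  refine wp_loop (fun j s' => s'.reg rK = s.reg rM - j ∧ s'.reg rX = s₁.arr aNb (s.reg rM - j) ∧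
    s'.reg rY = s.arr aCnt (s.reg rM - j)) (s.reg rM - kf) (fun _ => 3) ?_ ?_ ?_ ?_
  · simp [f5]
  · rintro j s' hj hf ⟨h₁, h₂, h₃⟩
    have g1 := hf.arr aNb rfl
    have g2 := hf.arr aCnt rfl
    simp only [Store.arr_setReg] at g1 g2
    refine ⟨by simp [h₂, h₃]; exact hk' _ (by omega) (by omega), ?_⟩
    have e : s.reg rM - j - 1 = s.reg rM - (j + 1) := by omega
    simp [h₁, g1, g2, f5, e, hnW, hcW]
    omega
  · rintro s' - ⟨h₁, h₂, h₃⟩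
    have e : s.reg rM - (s.reg rM - kf) = kf := by omega
    simpa [h₂, h₃, e] using hk
  · rintro t₂ s₂ ht₂ hf₂ ⟨h₁, -, -⟩
    have e : s.reg rM - (s.reg rM - kf) = kf := by omega
    rw [e] at h₁
    have g1 := hf₂.arr aNb rfl
    have g2 := hf₂.arr aCnt rfl
    have g3 := hf₂.arr aLev rfl
    have g4 := hf₂.arr aCls rfl
    have g5 := hf₂.reg rW rfl
    have g6 := hf₂.reg rM rfl
    have g7 := hf₂.reg rI rfl
    have g8 := hf₂.reg rN rfl
    have g9 := hf₂.arr aStart rfl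
    have g10 := hf₂.arr aAdj rfl
    have g11 := hf₂.arr aOrder rfl
    simp [f1, f2, f3, f4, f5, f6, f7, f8, f9, f10] at g1 g2 g3 g4 g5 g6 g7 g8 g9 g10 g11
    have hstep := hL.step hi hnb₁ hkM hk hk'
    have hc1 : s.arr aCnt (kf + 1) + 1 ≤ D.n + 1 := by have := hcle (kf + 1); omega
    have ht₂' : t₂ ≤ 17 + 11 * (D.N w).length := by
      simp at ht₂
      omega
    -- Both branches of the conditional lead to the same state, from which the counters are reset.
    have main : ∀ t₃ s₃, t₃ ≤ t₂ + 8 → s₃.arr = Function.update (Function.update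
        (Function.update s₂.arr aLev (Function.update (s.arr aLev) w (kf + 1)))
          aCls (Function.update (s.arr aCls) w (kf + 1)))
          aCnt (Function.update (s.arr aCnt) (kf + 1) (s.arr aCnt (kf + 1) + 1)) →
        s₃.reg rM = max (s.reg rM) (kf + 1) → s₃.reg rI = i → s₃.reg rW = w → s₃.reg rN = s.reg rN →
        wp W (scan (.assign rL (.read aLev (.reg rU)) ;; .write aNb (.reg rL) (.lit 0)))
        (fun t' s' => t' ≤ 30 + 16 * (D.N w).length ∧ s'.reg rI = i ∧
          D.LevelInv i (s'.arr aLev) (s'.arr aCnt) (s'.reg rM) ∧ (∀ l, s'.arr aNb l = 0) ∧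
          ∀ v, v < D.n → s'.arr aCls v = s'.arr aLev v) t₃ s₃ := by
      intro t₃ s₃ ht₃ ha hM hI hW' hN
      have a6 : s₃.arr aNb = s₁.arr aNb := by simp [ha, g1]
      have a4 : s₃.arr aLev = Function.update (s.arr aLev) w (kf + 1) := by simp [ha]
      have a7 : s₃.arr aCls = Function.update (s.arr aCls) w (kf + 1) := by simp [ha]
      have a5 : s₃.arr aCnt = Function.update (s.arr aCnt) (kf + 1) (s.arr aCnt (kf + 1) + 1) := by
        simp [ha]
      have hlev : ∀ u ∈ D.N w, s₃.arr aLev u = s.arr aLev u := fun u hu => by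
        rw [a4, Function.update_of_ne]
        rintro rfl
        exact D.irrefl _ hw hu
      refine wp_scan (D := D) (w := w) (c := 2) (hD.congr hN ?_ ?_ ?_) (by omega) ?_ hW' hw
        (fun k s' => ∀ l, s'.arr aNb l = 0 ∨ ∃ u ∈ (D.N w).drop k, s.arr aLev u = l)
        (fun k s x v _ h => h) ?_ ?_ ?_
      · simp [ha, g9]
      · simp [ha, g10]
      · simp [ha, g11]
      · simp [ScanBody, Program.setsReg, Program.setsArr]
      · intro l
        rw [a6, hnb₁]
        by_contra hne
        push Not at hne
        obtain ⟨h₁, h₂⟩ := hne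
        refine h₁ (List.countP_eq_zero.2 fun u hu => ?_)
        simpa using h₂ u (by simpa using hu)
      · intro k s' hk hf hIk hu
        have q4 := hf.arr aLev rfl
        have hm := List.getElem_mem hk
        have hle := hlevle _ (D.lt w hw _ hm)
        simp only [wp_seq, wp_assign, wp_write, Operation.val, Operand.val, Store.reg_setReg,
          Store.arr_setReg, Function.update_self, hu, q4, hlev _ hm, Store.arr_setCell]
        refine ⟨by omega, by omega, by omega, fun l => ?_⟩
        by_cases e : l = s.arr aLev (D.N w)[k]
        · subst e; simp
        · rw [Function.update_of_ne e]
          refine (hIk l).imp_right ?_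
          rintro ⟨u, hu, rfl⟩
          rw [List.drop_eq_getElem_cons hk] at hu
          rcases List.mem_cons.1 hu with rfl | hu
          · exact absurd rfl e
          · exact ⟨u, hu, rfl⟩
      · intro t₄ s₄ ht₄ hf₄ h₄
        have q1 := hf₄.arr aLev rfl
        have q2 := hf₄.arr aCnt rfl
        have q3 := hf₄.arr aCls rfl
        have q4 := hf₄.reg rM rfl
        have q5 := hf₄.reg rI rfl
        refine ⟨by omega, by rw [q5, hI], ?_, fun l => ?_, fun v hv => ?_⟩
        · rw [q1, q2, q4, a4, a5, hM]
          exact hstep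
        · simpa using h₄ l
        · rw [q1, q3, a4, a7]
          by_cases e : v = w
          · subst e; simp
          · rw [Function.update_of_ne e, Function.update_of_ne e, hcls v hv]
    simp [h₁, g2, g3, g4, g5, g6]
    refine ⟨by omega, by omega, by omega, fun hlt => ⟨by omega, main _ _ le_rfl ?_ ?_ ?_ ?_ ?_⟩,
      fun hlt => main _ _ le_rfl ?_ ?_ ?_ ?_ ?_⟩
    all_goals first
      | (simp [g2, g3, g4, g5, g6, g7, g8]; done)
      | (simp [g6]; omega)

theorem wp_levelPhase {D : OrderedGraph} {W t : ℕ} {s : Store} {Q : ℕ → Store → Prop}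
    (hD : D.Holds s) (hW : 2 * D.n + D.size + 1 ≤ W) (hM : s.reg rM = 0)
    (hlev : ∀ v, s.arr aLev v = 0) (hcnt : ∀ k, s.arr aCnt k = 0) (hnb : ∀ l, s.arr aNb l = 0)
    (hcls : ∀ v, s.arr aCls v = 0)
    (post : ∀ t' s', t' ≤ t + 3 + 31 * D.n + 16 * D.size → Frame levelPhase s s' →
      D.LevelInv 0 (s'.arr aLev) (s'.arr aCnt) (s'.reg rM) →
      (∀ v, v < D.n → s'.arr aCls v = s'.arr aLev v) → Q t' s') : wp W levelPhase Q t s := by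
  apply wp_frame
  unfold levelPhase
  simp only [wp_seq, wp_assign, wp_write, Operation.val, Operand.val, Store.reg_setCell, hD.size]
  refine ⟨by omega, by omega, ?_⟩
  refine wp_loop (fun j s' => s'.reg rI = D.n - j ∧
      D.LevelInv (D.n - j) (s'.arr aLev) (s'.arr aCnt) (s'.reg rM) ∧ (∀ l, s'.arr aNb l = 0) ∧
      ∀ v, v < D.n → s'.arr aCls v = s'.arr aLev v) D.n
    (fun j => 30 + 16 * (D.N (D.π (D.n - 1 - j))).length) ?_ ?_ ?_ ?_
  · refine ⟨by simp, ?_, by simpa using hnb, by simp [hlev, hcls]⟩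
    refine ⟨?_, ?_, ?_, ?_, ?_, ?_, ?_, ?_, ?_⟩
    · simp [hlev]
    · intro v hv h
      have := D.pos_lt v hv
      omega
    · simp [hlev]
    · intro u hu w hw h
      have := D.pos_lt w hw
      omega
    · intro w hw h
      have := D.pos_lt w hw
      omega
    · simp
    · intro k hk
      have : k ≠ 0 := by omega
      simp [hlev, hcnt, this, Ne.symm this]
    · simp [hM]
    · simp [hM]; omega
  · rintro j s' hj hf ⟨h₁, h₂, h₃, h₄⟩
    have e : D.n - j = D.n - 1 - j + 1 := by omega
    refine ⟨by simp [h₁]; omega, ?_⟩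
    rw [e] at h₁ h₂
    have e' : D.n - (j + 1) = D.n - 1 - j := by omega
    rw [e']
    refine wp_levelBody (hD.congr ?_ ?_ ?_ ?_) hW (by omega) h₁ h₂ h₃ h₄
    · have := hf.reg rN rfl
      simpa using this
    · have := hf.arr aStart rfl
      simpa using this
    · have := hf.arr aAdj rfl
      simpa using this
    · have := hf.arr aOrder rfl
      simpa using this
  · rintro s' - ⟨h₁, -⟩
    simp [h₁]
  · rintro t' s' ht' - ⟨-, h₂, -, h₄⟩ hf
    refine post t' s' ?_ hf (by simpa using h₂) h₄
    have := Finset.sum_range_reflect (fun i => (D.N (D.π i)).length) D.n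
    rw [D.sum_π fun v => (D.N v).length] at this
    simp only [Finset.sum_add_distrib, ← Finset.mul_sum, this, Finset.sum_const, Finset.card_range,
      smul_eq_mul] at ht'
    rw [OrderedGraph.size]
    omega

/-! ### Numbering the vertices level by level -/

namespace OrderedGraph

variable {D : OrderedGraph} {lev t : ℕ → ℕ}

/-- The vertices on the levels `1, …, h` are numbered, as `t 0, …, t (off - 1)`. -/
structure Numbering (D : OrderedGraph) (lev : ℕ → ℕ) (h off : ℕ) (t : ℕ → ℕ) : Prop where
  off_eq : off = ((Finset.range D.n).filter fun v => lev v ≤ h).card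
  lt : ∀ p, p < off → t p < D.n
  lev_le : ∀ p, p < off → lev (t p) ≤ h
  inj : ∀ p, p < off → ∀ q, q < off → t p = t q → p = q
  surj : ∀ v, v < D.n → lev v ≤ h → ∃ p, p < off ∧ t p = v
  mono : ∀ p q, p ≤ q → q < off → lev (t p) ≤ lev (t q)
  same : ∀ p q, p < q → q < off → lev (t p) = lev (t q) →
    D.lbl t p (t q) < D.lbl t p (t p) ∨
      D.lbl t p (t q) = D.lbl t p (t p) ∧ D.pos (t q) < D.pos (t p)

/-- Numbering common neighbours of two vertices does not affect the comparison of their labels. -/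
theorem lbl_extend {p q x y : ℕ} (hpq : p ≤ q)
    (h : ∀ k, p ≤ k → k < q → x ∈ D.N (t k) ∧ y ∈ D.N (t k)) :
    (D.lbl t p x < D.lbl t p y → D.lbl t q x < D.lbl t q y) ∧
      (D.lbl t p x = D.lbl t p y → D.lbl t q x = D.lbl t q y) := by
  induction q, hpq using Nat.le_induction with
  | base => exact ⟨id, id⟩
  | succ q hpq ih =>
    obtain ⟨h₁, h₂⟩ := ih fun k hk hk' => h k hk (by omega)
    obtain ⟨hx, hy⟩ := h q hpq (by omega)
    rw [lbl, lbl, if_pos hx, if_pos hy]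
    exact ⟨fun h' => List.cons_lt_cons_iff.2 (Or.inr ⟨rfl, h₁ h'⟩), fun h' => by rw [h₂ h']⟩

theorem filter_le_succ (lev : ℕ → ℕ) (n h : ℕ) :
    ((Finset.range n).filter fun v => lev v ≤ h + 1) =
      ((Finset.range n).filter fun v => lev v ≤ h).disjUnion
        ((Finset.range n).filter fun v => lev v = h + 1)
        (Finset.disjoint_filter.2 fun v _ h₁ h₂ => by omega) := by
  ext v
  simp only [Finset.mem_filter, Finset.mem_range, Finset.disjUnion_eq_union, Finset.mem_union]
  omega

theorem length_eq_card {F : List ℕ} {h : ℕ} (hF : ∀ v, v ∈ F ↔ v < D.n ∧ lev v = h)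
    (hnd : F.Nodup) : F.length = ((Finset.range D.n).filter fun v => lev v = h).card := by
  rw [← List.toFinset_card_of_nodup hnd]
  congr 1
  ext v
  simp [hF]

/-- The numbering of the next level, from the end to the beginning, by the list `F` of its
vertices in the order of increasing labels. -/
theorem Numbering.step {h off : ℕ} (hN : D.Numbering lev h off t) (hL : D.IsLevel lev)
    {t' : ℕ → ℕ} {F : List ℕ} (hF : ∀ v, v ∈ F ↔ v < D.n ∧ lev v = h + 1)
    (hs : F.Pairwise fun v w => labelOf (D.events t off) v < labelOf (D.events t off) w)
    (h₀ : ∀ k, k < off → t' k = t k)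
    (h₁ : ∀ i (hi : i < F.length), t' (off + F.length - 1 - i) = F[i]) :
    D.Numbering lev (h + 1) (off + F.length) t' := by
  have hnd : F.Nodup := hs.imp fun hlt e => by rw [e] at hlt; exact lt_irrefl _ hlt
  have hnew : ∀ p, off ≤ p → p < off + F.length →
      ∃ hi : off + F.length - 1 - p < F.length, t' p = F[off + F.length - 1 - p] := by
    intro p hp hp'
    refine ⟨by omega, ?_⟩
    rw [← h₁ _ (by omega)]
    congr 1
    omega
  have hnewF : ∀ p, off ≤ p → p < off + F.length → t' p < D.n ∧ lev (t' p) = h + 1 := by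
    intro p hp hp'
    obtain ⟨hi, e⟩ := hnew p hp hp'
    rw [e]
    exact (hF _).1 (List.getElem_mem hi)
  have hold : ∀ p, p < off → t' p < D.n ∧ lev (t' p) ≤ h := fun p hp => by
    rw [h₀ p hp]; exact ⟨hN.lt p hp, hN.lev_le p hp⟩
  have inj : ∀ p, p < off + F.length → ∀ q, q < off + F.length → t' p = t' q → p = q := by
    intro p hp q hq e
    rcases Nat.lt_or_ge p off with hp' | hp' <;> rcases Nat.lt_or_ge q off with hq' | hq'
    · rw [h₀ p hp', h₀ q hq'] at e
      exact hN.inj p hp' q hq' e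
    · have := (hold p hp').2
      have := (hnewF q hq' hq).2
      rw [e] at *
      omega
    · have := (hold q hq').2
      have := (hnewF p hp' hp).2
      rw [e] at *
      omega
    · obtain ⟨hi, e₁⟩ := hnew p hp' hp
      obtain ⟨hj, e₂⟩ := hnew q hq' hq
      rw [e₁, e₂] at e
      have := (hnd.getElem_inj_iff).1 e
      omega
  have hlt : ∀ p, p < off + F.length → t' p < D.n := fun p hp => by
    rcases Nat.lt_or_ge p off with hp' | hp'
    · exact (hold p hp').1
    · exact (hnewF p hp' hp).1
  refine ⟨?_, hlt, ?_, inj, ?_, ?_, ?_⟩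
  · rw [filter_le_succ, Finset.card_disjUnion, ← hN.off_eq, length_eq_card hF hnd]
  · intro p hp
    rcases Nat.lt_or_ge p off with hp' | hp'
    · exact (hold p hp').2.trans (Nat.le_succ h)
    · exact (hnewF p hp' hp).2.le
  · intro v hv hvh
    rcases Nat.lt_or_ge (lev v) (h + 1) with h' | h'
    · obtain ⟨p, hp, rfl⟩ := hN.surj v hv (by omega)
      exact ⟨p, by omega, h₀ p hp⟩
    · obtain ⟨i, hi, rfl⟩ := List.getElem_of_mem ((hF v).2 ⟨hv, by omega⟩)
      exact ⟨off + F.length - 1 - i, by omega, h₁ i hi⟩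
  · intro p q hpq hq
    rcases Nat.lt_or_ge q off with hq' | hq'
    · rw [h₀ p (by omega), h₀ q hq']
      exact hN.mono p q hpq hq'
    · rw [(hnewF q hq' hq).2]
      rcases Nat.lt_or_ge p off with hp' | hp'
      · exact (hold p hp').2.trans (Nat.le_succ h)
      · exact (hnewF p hp' (by omega)).2.le
  · intro p q hpq hq hl
    rcases Nat.lt_or_ge q off with hq' | hq'
    · have hc : ∀ w, D.lbl t' p w = D.lbl t p w := lbl_congr fun k hk => h₀ k (by omega)
      rw [h₀ p (by omega), h₀ q hq'] at hl ⊢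
      rw [hc, hc]
      exact hN.same p q hpq hq' hl
    · have hql := hnewF q hq' hq
      rcases Nat.lt_or_ge p off with hp' | hp'
      · have := (hold p hp').2
        omega
      have hpl := hnewF p hp' (by omega)
      obtain ⟨hi, e₁⟩ := hnew p hp' (by omega)
      obtain ⟨hj, e₂⟩ := hnew q hq' hq
      have hcmp := List.pairwise_iff_getElem.1 hs _ _ hj hi (by omega)
      rw [← e₁, ← e₂, labelOf_events hql.1 hN.lt, labelOf_events hpl.1 hN.lt] at hcmp
      have hc : ∀ w, D.lbl t off w = D.lbl t' off w := lbl_congr fun k hk => (h₀ k hk).symm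
      rw [hc, hc] at hcmp
      have hadj : ∀ k, off ≤ k → k < p → t' q ∈ D.N (t' k) ∧ t' p ∈ D.N (t' k) := by
        intro k hk hkp
        have hkl := hnewF k hk (by omega)
        exact ⟨hL.adj hkl.1 hql.1 (fun e => by
            have := inj k (by omega) q (by omega) e; omega) (by omega),
          hL.adj hkl.1 hpl.1 (fun e => by
            have := inj k (by omega) p (by omega) e; omega) (by omega)⟩
      have hext := lbl_extend hp' hadj
      rcases shifted_lt (fun x hx => pos_of_mem_lbl hx) (D.pos_lt _ hpl.1)
        (fun x hx => pos_of_mem_lbl hx) hcmp with h' | ⟨h', h''⟩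
      · exact Or.inl (hext.1 h')
      · exact Or.inr ⟨hext.2 h', by omega⟩

theorem length_levelEvents {l : List (ℕ × ℕ)} (hl : ∀ e ∈ l, e.2 < D.n) (h : ℕ) :
    (levelEvents lev l h).length =
      ∑ w ∈ (Finset.range D.n).filter fun v => lev v = h, (labelOf l w).length := by
  induction l with
  | nil => simp [levelEvents, labelOf]
  | cons e l ih =>
    have ih := ih fun e' he' => hl e' (by simp [he'])
    have he := hl e (by simp)
    have : ∀ w, (labelOf (e :: l) w).length =
        (labelOf l w).length + if e.2 = w then 1 else 0 := by
      intro w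
      rw [← List.singleton_append, labelOf_append, labelOf_singleton, List.length_append,
        Nat.add_comm]
      split_ifs <;> rfl
    simp only [this, Finset.sum_add_distrib, ← ih, Finset.sum_ite_eq, Finset.mem_filter,
      Finset.mem_range, he, true_and]
    by_cases h' : lev e.2 = h <;> simp [levelEvents, h']

theorem lt_of_mem_events {p : ℕ} (ht : ∀ k, k < p → t k < D.n) {e : ℕ × ℕ}
    (he : e ∈ D.events t p) : 1 ≤ e.1 ∧ e.1 ≤ D.n + p ∧ e.2 < D.n := by
  obtain ⟨q, w⟩ := e
  rcases mem_events.1 he with ⟨h₁, h₂, rfl⟩ | ⟨k, hk, rfl, hw⟩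
  · exact ⟨h₁, by simp; omega, D.π_lt _ (by omega)⟩
  · exact ⟨by simp, by simp; omega, D.lt _ (ht k hk) _ hw⟩

/-- The sum over the vertices of level `h` of one plus the degree, which bounds the time spent on
this level. -/
def weight (D : OrderedGraph) (lev : ℕ → ℕ) (h : ℕ) : ℕ :=
  ∑ v ∈ (Finset.range D.n).filter fun v => lev v = h, ((D.N v).length + 1)

/-- The sum of the weights of the levels `0, …, h`. -/
def weightLe (D : OrderedGraph) (lev : ℕ → ℕ) (h : ℕ) : ℕ :=
  ∑ v ∈ (Finset.range D.n).filter fun v => lev v ≤ h, ((D.N v).length + 1)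

theorem weightLe_succ (h : ℕ) :
    D.weightLe lev (h + 1) = D.weightLe lev h + D.weight lev (h + 1) := by
  rw [weightLe, filter_le_succ, Finset.sum_disjUnion]
  rfl

theorem weightLe_le (h : ℕ) : D.weightLe lev h ≤ D.n + D.size := by
  refine (Finset.sum_le_sum_of_subset (Finset.filter_subset _ _)).trans ?_
  simp [Finset.sum_add_distrib, size, Nat.add_comm]

theorem sum_weight_le (h : ℕ) : ∑ k ∈ Finset.range h, D.weight lev (k + 1) ≤ D.n + D.size := by
  refine le_trans (?_ : _ ≤ D.weightLe lev h) (weightLe_le h)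
  induction h with
  | zero => simp
  | succ h ih =>
    rw [Finset.sum_range_succ, weightLe_succ]
    omega

theorem Numbering.length_levelEvents_le {h off : ℕ} (hN : D.Numbering lev h off t) (k : ℕ) :
    (levelEvents lev (D.events t off) k).length ≤ D.weight lev k := by
  rw [length_levelEvents (fun e he => (lt_of_mem_events hN.lt he).2.2)]
  refine Finset.sum_le_sum fun w hw => ?_
  have hw := Finset.mem_range.1 (Finset.mem_filter.1 hw).1
  rw [labelOf_events hw hN.lt]
  have := length_lbl_le hw hN.lt hN.inj
  simpa using this

/-- The time spent on the vertices that are numbered on one level. -/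
theorem Numbering.sum_new {h off c : ℕ} (hN : D.Numbering lev (h + 1) (off + c) t)
    (hold : ∀ p, p < off → lev (t p) ≤ h) (hnew : ∀ k, k < c → lev (t (off + k)) = h + 1) :
    ∑ k ∈ Finset.range c, ((D.N (t (off + k))).length + 1) = D.weight lev (h + 1) := by
  refine Finset.sum_bij (fun k _ => t (off + k)) (fun k hk => ?_) (fun k hk l hl e => ?_)
    (fun v hv => ?_) fun _ _ => rfl
  · have hk := Finset.mem_range.1 hk
    simp only [Finset.mem_filter, Finset.mem_range]
    exact ⟨hN.lt _ (by omega), hnew k hk⟩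
  · have hk := Finset.mem_range.1 hk
    have hl := Finset.mem_range.1 hl
    have := hN.inj _ (by omega) _ (by omega) e
    omega
  · simp only [Finset.mem_filter, Finset.mem_range] at hv
    obtain ⟨p, hp, rfl⟩ := hN.surj v hv.1 hv.2.le
    have : off ≤ p := by
      by_contra hlt
      have := hold p (by omega)
      omega
    exact ⟨p - off, by simp; omega, by simp [Nat.add_sub_cancel' this]⟩

theorem Numbering.length_events_le {h off p : ℕ} (hN : D.Numbering lev h off t) (hp : p ≤ off) :
    (D.events t p).length ≤ D.n + D.size := by
  have h₁ : ∀ p, (D.events t p).length = D.n + ∑ k ∈ Finset.range p, (D.N (t k)).length := by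
    intro p
    induction p with
    | zero =>
      have : ∀ i, (D.tieEvents i).length = i := fun i => by
        induction i with
        | zero => rfl
        | succ i ih => simp [tieEvents, ih]
      simp [events, this]
    | succ p ih =>
      rw [events, List.length_append, ih, Finset.sum_range_succ]
      simp
      omega
  rw [h₁, size]
  have hinj : Set.InjOn t (Finset.range p) := fun k hk l hl e => by
    simp only [Finset.coe_range, Set.mem_Iio] at hk hl
    exact hN.inj k (by omega) l (by omega) e
  rw [← Finset.sum_image (f := fun v => (D.N v).length) hinj]
  refine Nat.add_le_add_left (Finset.sum_le_sum_of_subset fun v hv => ?_) _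
  obtain ⟨k, hk, rfl⟩ := Finset.mem_image.1 hv
  rw [Finset.mem_range] at hk ⊢
  exact hN.lt k (by omega)

end OrderedGraph

/-! ### Recording events -/

/-- The store holds the events in `l`, the latest first, as one linked list for each level. The node
of an event is the number of events recorded so far. -/
structure EventInv (lev : ℕ → ℕ) (l : List (ℕ × ℕ)) (s : Store) : Prop where
  count : s.reg rT = l.length
  chain : ∀ h, EventChain (s.arr aEvNext) (s.arr aEvPiv) (s.arr aEvVert) l.length
    (s.arr aEvHead h) (OrderedGraph.levelEvents lev l h)

theorem EventChain.le {nx pv vt : ℕ → ℕ} {T a : ℕ} {l : List (ℕ × ℕ)}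
    (h : EventChain nx pv vt T a l) : a ≤ T := by
  cases l with
  | nil =>
    have : a = 0 := h
    omega
  | cons e l => exact h.2.1

theorem EventInv.congr {lev : ℕ → ℕ} {l : List (ℕ × ℕ)} {s s' : Store} (h : EventInv lev l s)
    (h₀ : s'.reg rT = s.reg rT) (h₁ : s'.arr aEvNext = s.arr aEvNext)
    (h₂ : s'.arr aEvPiv = s.arr aEvPiv) (h₃ : s'.arr aEvVert = s.arr aEvVert)
    (h₄ : s'.arr aEvHead = s.arr aEvHead) : EventInv lev l s' := by
  refine ⟨h₀.trans h.count, fun k => ?_⟩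
  rw [h₁, h₂, h₃, h₄]
  exact h.chain k

/-- Record the event `(rQ, rU)`. -/
def pushEvent : Program :=
  .assign rL (.read aLev (.reg rU)) ;;
  .assign rE (.read aEvHead (.reg rL)) ;;
  .assign rT (.add (.reg rT) (.lit 1)) ;;
  .write aEvNext (.reg rT) (.reg rE) ;;
  .write aEvHead (.reg rL) (.reg rT) ;;
  .write aEvPiv (.reg rT) (.reg rQ) ;;
  .write aEvVert (.reg rT) (.reg rU)

theorem wp_pushEvent {lev : ℕ → ℕ} {W t q u : ℕ} {l : List (ℕ × ℕ)} {s : Store}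
    {Q : ℕ → Store → Prop} (hE : EventInv lev l s) (hlev : s.arr aLev u = lev u)
    (hQ : s.reg rQ = q) (hU : s.reg rU = u) (hWl : lev u ≤ W) (hWT : l.length + 1 ≤ W)
    (hWq : q ≤ W) (hWu : u ≤ W)
    (post : ∀ s', Frame pushEvent s s' → EventInv lev ((q, u) :: l) s' → Q (t + 7) s') :
    wp W pushEvent Q t s := by
  apply wp_frame
  unfold pushEvent
  have hhead := (hE.chain (lev u)).le
  simp only [wp_seq, wp_assign, wp_write, Operation.val, Operand.val, Store.reg_setReg,
    Store.arr_setReg, Store.reg_setCell, Function.update_self, hU, hlev]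
  simp only [ne_eq, Nat.reduceEqDiff, not_false_eq_true, Function.update_of_ne,
    Function.update_self, hE.count, hQ, hU]
  refine ⟨hWl, by omega, hWT, by omega, hWT, hWq, hWu, fun hf => post _ hf ⟨by simp, fun h => ?_⟩⟩
  simp only [Store.arr_setCell, Store.arr_setReg, ne_eq, Nat.reduceEqDiff, not_false_eq_true,
    Function.update_of_ne, Function.update_self]
  by_cases e : h = lev u
  · subst e
    have : OrderedGraph.levelEvents lev ((q, u) :: l) (lev u) =
        (q, u) :: OrderedGraph.levelEvents lev l (lev u) := by simp [OrderedGraph.levelEvents]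
    rw [this, Function.update_self]
    refine ⟨by simp, by simp, by simp, by simp, ?_⟩
    rw [Function.update_self]
    exact (hE.chain _).push
  · have : OrderedGraph.levelEvents lev ((q, u) :: l) h = OrderedGraph.levelEvents lev l h := by
      simp [OrderedGraph.levelEvents, Ne.symm e]
    rw [this, Function.update_of_ne e]
    exact (hE.chain _).push

/-- Record the tie-breaking events. -/
def tiePhase : Program :=
  .assign rI (.copy (.lit 0)) ;;
  .loop (.lt (.reg rI) (.reg rN))
    (.assign rU (.read aOrder (.reg rI)) ;;
    .assign rI (.add (.reg rI) (.lit 1)) ;;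
    .assign rQ (.copy (.reg rI)) ;;
    pushEvent)

theorem wp_tiePhase {D : OrderedGraph} {lev : ℕ → ℕ} {W t : ℕ} {s : Store}
    {Q : ℕ → Store → Prop} (hD : D.Holds s) (hW : D.n + 1 ≤ W) (hlev : s.arr aLev = lev)
    (hle : ∀ v, v < D.n → lev v ≤ D.n) (hE : EventInv lev [] s)
    (post : ∀ t' s', t' ≤ t + 2 + 11 * D.n → Frame tiePhase s s' →
      EventInv lev (D.tieEvents D.n) s' → Q t' s') : wp W tiePhase Q t s := by
  apply wp_frame
  unfold tiePhase
  simp only [wp_seq, wp_assign, Operation.val, Operand.val]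
  have hlen : ∀ i, (D.tieEvents i).length = i := fun i => by
    induction i with
    | zero => rfl
    | succ i ih => simp [OrderedGraph.tieEvents, ih]
  refine ⟨by omega, wp_loop (fun i s' => s'.reg rI = i ∧ EventInv lev (D.tieEvents i) s') D.n
    (fun _ => 10) ?_ ?_ ?_ ?_⟩
  · exact ⟨by simp, hE.congr (by simp) rfl rfl rfl rfl⟩
  · rintro i s' hi hf ⟨hI, hE'⟩
    have f0 := hf.reg rN rfl
    have f2 := hf.arr aOrder rfl
    have f4 := hf.arr aLev rfl
    simp [hD.size] at f0 f2 f4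
    have hπ := D.π_lt i hi
    refine ⟨by simp [hI, f0, hi], ?_⟩
    simp only [wp_seq, wp_assign, Operation.val, Operand.val, Store.reg_setReg,
      hI, f2, hD.order i hi, Function.update_self, ne_eq, Nat.reduceEqDiff, not_false_eq_true,
      Function.update_of_ne]
    refine ⟨by omega, by simp; omega, by simp; omega, ?_⟩
    refine wp_pushEvent (lev := lev) (l := D.tieEvents i) (q := i + 1) (u := D.π i)
      (hE'.congr (by simp) rfl rfl rfl rfl) (by simp [f4, hlev]) (by simp) (by simp)
      ((hle _ hπ).trans (by omega)) (by rw [hlen]; omega) (by omega) (by omega) ?_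
    intro s'' hf'' hE''
    refine ⟨by omega, ?_, hE''⟩
    have := hf''.reg rI rfl
    simpa [hI] using this
  · rintro s' hf ⟨hI, -⟩
    have f0 := hf.reg rN rfl
    simp [hD.size] at f0
    simp [f0, hI]
  · rintro t' s' ht' - ⟨-, hE'⟩ hf
    refine post t' s' ?_ hf hE'
    simp at ht'
    omega

/-- Record the events that the numbering of the vertices in the positions `rOff, …, rEnd - 1` of the
output gives rise to. -/
def numberPhase : Program :=
  .loop (.lt (.reg rOff) (.reg rEnd))
    (.assign rW (.read aOut (.reg rOff)) ;;
    .assign rOff (.add (.reg rOff) (.lit 1)) ;;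
    .assign rQ (.add (.reg rOff) (.reg rN)) ;;
    scan pushEvent)

theorem wp_numberPhase {D : OrderedGraph} {lev τ : ℕ → ℕ} {W t h off c : ℕ} {s : Store}
    {Q : ℕ → Store → Prop} (hD : D.Holds s) (hW : 2 * D.n + D.size + 1 ≤ W)
    (hlev : s.arr aLev = lev) (hle : ∀ v, v < D.n → lev v ≤ D.n) (hτ : s.arr aOut = τ)
    (hN : D.Numbering lev h (off + c) τ) (hoff : s.reg rOff = off) (hend : s.reg rEnd = off + c)
    (hE : EventInv lev (D.events τ off) s)
    (post : ∀ t' s', t' ≤ t + 1 +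
        10 * ∑ k ∈ Finset.range c, ((D.N (τ (off + k))).length + 1) → Frame numberPhase s s' →
      s'.reg rOff = off + c → EventInv lev (D.events τ (off + c)) s' → Q t' s') :
    wp W numberPhase Q t s := by
  apply wp_frame
  unfold numberPhase
  have hcn : off + c ≤ D.n := by
    rw [hN.off_eq]
    exact (Finset.card_filter_le _ _).trans (by simp)
  refine wp_loop (fun k s' => s'.reg rOff = off + k ∧ EventInv lev (D.events τ (off + k)) s') c
    (fun k => 7 + 10 * (D.N (τ (off + k))).length) ?_ ?_ ?_ ?_
  · exact ⟨hoff, hE⟩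
  · rintro k s' hk hf ⟨hO, hE'⟩
    have f0 := hf.reg rN rfl
    have f1 := hf.reg rEnd rfl
    have f3 := hf.arr aOut rfl
    have f4 := hf.arr aLev rfl
    have hw := hN.lt (off + k) (by omega)
    have hlen := hN.length_events_le (p := off + k + 1) (by omega)
    rw [OrderedGraph.events, List.length_append, List.length_map, List.length_reverse] at hlen
    refine ⟨by simp [hO, f1, hend, hk], ?_⟩
    simp only [wp_seq, wp_assign, Operation.val, Operand.val, Store.reg_setReg,
      hO, f3, hτ, f0, hD.size, Function.update_self, ne_eq, Nat.reduceEqDiff, not_false_eq_true,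
      Function.update_of_ne]
    refine ⟨by omega, by omega, by omega, ?_⟩
    refine wp_scan (D := D) (w := τ (off + k)) (c := 7) (hD.congr ?_ ?_ ?_ ?_) (by omega) ?_
      (by simp) hw (fun j s' => s'.arr aLev = lev ∧ s'.reg rQ = D.n + (off + k) + 1 ∧
        EventInv lev (((D.N (τ (off + k))).take j).reverse.map
          (fun u => (D.n + (off + k) + 1, u)) ++ D.events τ (off + k)) s') ?_ ?_ ?_ ?_
    · simp [f0]
    · exact hf.arr aStart rfl
    · exact hf.arr aAdj rfl
    · exact hf.arr aOrder rfl
    · simp [ScanBody, pushEvent, Program.setsReg, Program.setsArr]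
    · rintro j s x v hx ⟨h₁, h₂, h₃⟩
      refine ⟨h₁, ?_, h₃.congr ?_ rfl rfl rfl rfl⟩
      · rcases hx with rfl | rfl | rfl <;> simpa using h₂
      · rcases hx with rfl | rfl | rfl <;> simp
    · refine ⟨by simp [f4, hlev], ?_, ?_⟩
      · simp; omega
      · exact hE'.congr (by simp) rfl rfl rfl rfl
    · rintro j s'' hj hf'' ⟨h₁, h₂, h₃⟩ hu
      have hun := D.lt _ hw _ (List.getElem_mem hj)
      refine wp_pushEvent h₃ (by rw [h₁]) h₂ hu ((hle _ hun).trans (by omega)) ?_ (by omega)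
        (by omega) ?_
      · rw [List.length_append, List.length_map, List.length_reverse, List.length_take]
        omega
      · intro s₃ hf₃ hE₃
        refine ⟨by omega, ?_, ?_, ?_⟩
        · rw [hf₃.arr aLev rfl, h₁]
        · rw [hf₃.reg rQ rfl, h₂]
        · rw [List.take_succ_eq_append_getElem hj, List.reverse_append, List.map_append]
          exact hE₃
    · rintro t₁ s₁ ht₁ hf₁ ⟨-, -, h₃⟩
      refine ⟨by omega, ?_, ?_⟩
      · have := hf₁.reg rOff rfl
        simp at this
        omega
      · rw [List.take_length] at h₃
        exact h₃
  · rintro s' hf ⟨hO, -⟩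
    have f1 := hf.reg rEnd rfl
    simp [hO, f1, hend]
  · rintro t' s' ht' - ⟨hO, hE'⟩ hf
    refine post t' s' (ht'.trans ?_) hf hO hE'
    rw [Nat.add_right_comm, Finset.mul_sum]
    refine Nat.add_le_add_left (Finset.sum_le_sum fun k _ => ?_) _
    omega

/-! ### The refinement of one level -/

/-- Move the vertex of the event in the node `rE` to the class created by the pivot of this event
right after the present class of the vertex; create this class if need be. -/
def refineBody : Program :=
  .assign rW (.read aEvVert (.reg rE)) ;;
  .assign rQ (.read aEvPiv (.reg rE)) ;;
  .assign rC (.read aCls (.reg rW)) ;;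
  .assign rD (.read aNext (.reg rC)) ;;
  .assign rX (.read aPiv (.reg rD)) ;;
  .cond (.eq (.reg rX) (.reg rQ)) .skip
    (.assign rZ (.add (.reg rZ) (.lit 1)) ;;
    .write aNext (.reg rZ) (.reg rD) ;;
    .write aNext (.reg rC) (.reg rZ) ;;
    .write aPiv (.reg rZ) (.reg rQ) ;;
    .assign rD (.copy (.reg rZ))) ;;
  .write aCls (.reg rW) (.reg rD) ;;
  .assign rE (.read aEvNext (.reg rE))

/-- Refine the level `rH` by its events. -/
def refinePhase : Program :=
  .assign rE (.read aEvHead (.reg rH)) ;;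
  .loop (.lt (.lit 0) (.reg rE)) refineBody

namespace ClassInv

variable {n h : ℕ} {lev : ℕ → ℕ} {pre : List (ℕ × ℕ)} {cls nx pv : ℕ → ℕ} {K w : ℕ}
  {cl : List (ℕ × List ℕ)}

theorem id_le (hI : ClassInv n h lev pre cls nx pv K cl) (hhn : h ≤ n) {e : ℕ × List ℕ}
    (he : e ∈ cl) : e.1 ≤ K := by
  have := hI.le
  rcases hI.id e he with h' | h' <;> omega

/-- The class after the one of `w`, if there is any, is one of the list. -/
theorem next_cases (hI : ClassInv n h lev pre cls nx pv K cl) (hw : w < n) (hwh : lev w = h) :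
    nx (cls w) = 0 ∨ ∃ e ∈ cl, e.1 = nx (cls w) := by
  obtain ⟨A, B, hcl⟩ := List.append_of_mem (hI.mem w hw hwh)
  have hch := hI.chain
  rw [hcl, List.map_append, List.map_cons] at hch
  have hB := hch.drop
  rcases B with _ | ⟨e, B⟩
  · exact Or.inl hB
  · exact Or.inr ⟨e, by rw [hcl]; simp, hB.1.symm⟩

theorem pv_le (hI : ClassInv n h lev pre cls nx pv K cl) {b : ℕ} (hb : ∀ e ∈ pre, e.1 ≤ b)
    {e : ℕ × List ℕ} (he : e ∈ cl) : pv e.1 ≤ b := by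
  rw [hI.piv e he]
  rcases hI.pref e he with h' | ⟨v, -, -, h'⟩
  · simp [h']
  · rcases eq_or_ne e.2 [] with h0 | h0
    · simp [h0]
    · simp only [List.getLastD_eq_getLast?, List.getLast?_eq_some_getLast h0, Option.getD_some]
      exact hb _ (OrderedGraph.mem_labelOf.1 (h'.subset (List.getLast_mem h0)))

end ClassInv

theorem wp_refinePhase {n h W t : ℕ} {lev : ℕ → ℕ} {E : List (ℕ × ℕ)} {T : ℕ} {s : Store}
    {Q : ℕ → Store → Prop} (hhn : h ≤ n) (hH : s.reg rH = h)
    (hE : EventChain (s.arr aEvNext) (s.arr aEvPiv) (s.arr aEvVert) T (s.arr aEvHead h) E)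
    (hT : T ≤ W) (hn : 2 * n ≤ W) (hEb : ∀ e ∈ E, 1 ≤ e.1 ∧ e.1 ≤ 2 * n ∧ e.2 < n ∧ lev e.2 = h)
    (hd : OrderedGraph.Descending E) (hK : s.reg rZ + E.length ≤ W)
    (hI : ClassInv n h lev [] (s.arr aCls) (s.arr aNext) (s.arr aPiv) (s.reg rZ) [(h, [])])
    (post : ∀ t' s' cl, t' ≤ t + 2 + 14 * E.length → Frame refinePhase s s' →
      ClassInv n h lev E (s'.arr aCls) (s'.arr aNext) (s'.arr aPiv) (s'.reg rZ) cl →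
      s'.reg rZ ≤ s.reg rZ + E.length → Q t' s') : wp W refinePhase Q t s := by
  apply wp_frame
  unfold refinePhase
  simp only [wp_seq, wp_assign, Operation.val, Operand.val, hH]
  refine ⟨hE.le.trans hT, ?_⟩
  refine wp_loop (fun j s' => (∃ cl, ClassInv n h lev (E.take j) (s'.arr aCls) (s'.arr aNext)
      (s'.arr aPiv) (s'.reg rZ) cl) ∧ s'.reg rZ ≤ s.reg rZ + j ∧
      EventChain (s.arr aEvNext) (s.arr aEvPiv) (s.arr aEvVert) T (s'.reg rE) (E.drop j))
    E.length (fun _ => 13) ?_ ?_ ?_ ?_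
  · refine ⟨⟨_, hI⟩, by simp, by simpa using hE⟩
  · rintro j s' hj hf ⟨⟨cl, hcl⟩, hZ, hch⟩
    have f1 := hf.arr aEvNext rfl
    have f2 := hf.arr aEvPiv rfl
    have f3 := hf.arr aEvVert rfl
    simp only [Store.arr_setReg] at f1 f2 f3
    rw [List.drop_eq_getElem_cons hj] at hch
    obtain ⟨hne, -, hq, hv, hrest⟩ := hch
    obtain ⟨b₁, b₂, b₃, b₄⟩ := hEb _ (List.getElem_mem hj)
    have hdj : OrderedGraph.Descending (E.take j ++ [(E[j].1, E[j].2)]) := by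
      have := List.Pairwise.sublist (List.take_sublist (j + 1) E) hd
      rwa [List.take_succ_eq_append_getElem hj] at this
    have hcW : s'.arr aCls E[j].2 ≤ W := (hcl.id_le hhn (hcl.mem _ b₃ b₄)).trans (by omega)
    have hnW : s'.arr aNext (s'.arr aCls E[j].2) ≤ W ∧
        s'.arr aPiv (s'.arr aNext (s'.arr aCls E[j].2)) ≤ W := by
      rcases hcl.next_cases b₃ b₄ with h0 | ⟨e, he, h0⟩
      · rw [h0, hcl.pv_zero 0 (by omega)]
        omega
      · rw [← h0]
        exact ⟨(hcl.id_le hhn he).trans (by omega),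
          (hcl.pv_le (fun e' he' => (hEb e' (List.mem_of_mem_take he')).2.1) he).trans hn⟩
    have hrW := hrest.le.trans hT
    rw [← f1] at hrW
    refine ⟨by simp; omega, ?_⟩
    unfold refineBody
    simp only [wp_seq, wp_assign, wp_cond, wp_skip, wp_write, Operation.val, Operand.val,
      Test.holds, Store.reg_setReg, Store.arr_setReg, Store.reg_setCell, Function.update_self,
      ne_eq, Nat.reduceEqDiff, not_false_eq_true, Function.update_of_ne, f2, f3, hq, hv]
    refine ⟨by omega, by omega, hcW, hnW.1, hnW.2, fun hpv => ?_, fun hpv => ?_⟩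
    · simp only [Store.arr_setCell, Store.arr_setReg, ne_eq, Nat.reduceEqDiff,
        not_false_eq_true, Function.update_of_ne]
      refine ⟨hnW.1, hrW, by omega, ⟨cl, ?_⟩, by omega, by rwa [f1]⟩
      rw [List.take_succ_eq_append_getElem hj]
      simpa using hcl.move hdj b₁ b₃ b₄ hpv
    · simp only [Store.arr_setCell, Store.arr_setReg, ne_eq, Nat.reduceEqDiff,
        not_false_eq_true, Function.update_of_ne, Function.update_self]
      refine ⟨by omega, hnW.1, by omega, by omega, by omega, by omega, hrW, by omega, ?_, by omega,
        by rwa [f1]⟩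
      rw [List.take_succ_eq_append_getElem hj]
      obtain ⟨cl', hcl'⟩ := hcl.split hhn hdj b₃ b₄ hpv
      exact ⟨cl', by simpa using hcl'⟩
  · rintro s' - ⟨-, -, hch⟩
    rw [List.drop_length] at hch
    have h0 : s'.reg rE = 0 := hch
    simp [h0]
  · rintro t' s' ht' - ⟨⟨cl, hcl⟩, hZ, -⟩ hf
    rw [List.take_length] at hcl
    refine post t' s' cl ?_ hf hcl hZ
    simp at ht'
    omega

/-- Number the vertices of level `rH`, from the last one to the first one, in the order of the class
list. -/
def collectPhase : Program :=
  .assign rEnd (.read aCnt (.reg rH)) ;;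
  .assign rEnd (.add (.reg rEnd) (.reg rOff)) ;;
  .assign rP (.copy (.reg rEnd)) ;;
  .assign rC (.read aNext (.reg rH)) ;;
  .loop (.lt (.lit 0) (.reg rC))
    (.assign rQ (.read aPiv (.reg rC)) ;;
    .cond (.lt (.reg rN) (.reg rQ)) .skip
      (.assign rQ (.sub (.reg rQ) (.lit 1)) ;;
      .assign rW (.read aOrder (.reg rQ)) ;;
      .assign rP (.sub (.reg rP) (.lit 1)) ;;
      .write aOut (.reg rP) (.reg rW)) ;;
    .assign rC (.read aNext (.reg rC)))

theorem wp_collectPhase {D : OrderedGraph} {W t h off : ℕ} {s : Store} {Q : ℕ → Store → Prop}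
    {cl : List (ℕ × List ℕ)} (hD : D.Holds s) (hn : 0 < D.n) (hW : D.n ≤ W)
    (hH : s.reg rH = h) (hoff : s.reg rOff = off)
    (hcnt : s.arr aCnt h = (D.finalVertices cl).length)
    (hend : off + (D.finalVertices cl).length ≤ D.n)
    (hch : Linked (s.arr aNext) (s.arr aNext h) (cl.map Prod.fst))
    (hpv : ∀ e ∈ cl, s.arr aPiv e.1 = e.2.getLastD 0)
    (hid : ∀ e ∈ cl, e.1 ≤ W) (hpvW : ∀ e ∈ cl, s.arr aPiv e.1 ≤ W)
    (post : ∀ t' s', t' ≤ t + 5 + 9 * cl.length → Frame collectPhase s s' →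
      s'.reg rEnd = off + (D.finalVertices cl).length →
      (∀ k, k < off → s'.arr aOut k = s.arr aOut k) →
      (∀ i (hi : i < (D.finalVertices cl).length),
        s'.arr aOut (off + (D.finalVertices cl).length - 1 - i) = (D.finalVertices cl)[i]) →
      Q t' s') : wp W collectPhase Q t s := by
  apply wp_frame
  unfold collectPhase
  have hlink : ∀ {l : List (ℕ × List ℕ)} {a : ℕ}, (∀ e ∈ l, e.1 ≤ W) →
      Linked (s.arr aNext) a (l.map Prod.fst) → a ≤ W := by
    intro l a hl hc
    rcases l with _ | ⟨e, l⟩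
    · have : a = 0 := hc
      omega
    · rw [hc.1]
      exact hl e (by simp)
  set F := D.finalVertices cl with hF
  have hFapp : ∀ l l', D.finalVertices (l ++ l') = D.finalVertices l ++ D.finalVertices l' :=
    fun l l' => by simp [OrderedGraph.finalVertices]
  simp only [wp_seq, wp_assign, Operation.val, Operand.val, Store.reg_setReg, Store.arr_setReg,
      Function.update_self, ne_eq, Nat.reduceEqDiff, not_false_eq_true, Function.update_of_ne, hH,
      hoff, hcnt]
  refine ⟨by omega, by omega, by omega, hlink hid hch, ?_⟩
  -- After `j` classes, the output holds the final vertices of these, from the end of the level on.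
  refine wp_loop (fun j s' => Linked (s.arr aNext) (s'.reg rC) ((cl.drop j).map Prod.fst) ∧
      s'.reg rP = off + F.length - (D.finalVertices (cl.take j)).length ∧
      (∀ k, k < off → s'.arr aOut k = s.arr aOut k) ∧
      (∀ i (hi : i < (D.finalVertices (cl.take j)).length),
        s'.arr aOut (off + F.length - 1 - i) = (D.finalVertices (cl.take j))[i]))
    cl.length (fun _ => 8) ?_ ?_ ?_ ?_
  · refine ⟨by simpa using hch, ?_, fun _ _ => rfl, ?_⟩
    · simp [OrderedGraph.finalVertices, Nat.add_comm]
    · intro i hi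
      simp [OrderedGraph.finalVertices] at hi
  · rintro j s' hj hf ⟨hc, hP, ho, hi⟩
    have f1 := hf.arr aPiv rfl
    have f2 := hf.arr aOrder rfl
    have f3 := hf.arr aNext rfl
    have f4 := hf.reg rN rfl
    simp [hD.size] at f1 f2 f3 f4
    have hm := List.getElem_mem hj
    rw [List.drop_eq_getElem_cons hj, List.map_cons] at hc
    have hnW := hlink (fun e he => hid e (List.mem_of_mem_drop he)) hc.2.2
    have hFj : F.length = (D.finalVertices (cl.take j)).length +
        (D.finalVertices (cl.drop j)).length := by
      rw [← List.length_append, ← hFapp, List.take_append_drop]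
    refine ⟨by simp [hc.1]; exact Nat.pos_of_ne_zero hc.2.1, ?_⟩
    simp only [wp_seq, wp_assign, wp_cond, wp_skip, wp_write, Operation.val, Operand.val,
      Test.holds, Store.reg_setReg, Store.arr_setReg, Store.reg_setCell, Function.update_self,
      ne_eq, Nat.reduceEqDiff, not_false_eq_true, Function.update_of_ne, f1, f2, f3, f4, hc.1,
      OfNat.zero_ne_ofNat]
    refine ⟨hpvW _ hm, fun hlt => ?_, fun hle => ?_⟩
    · have hFs : D.finalVertices (cl.take (j + 1)) = D.finalVertices (cl.take j) := by
        rw [List.take_succ_eq_append_getElem hj, hFapp]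
        have : D.finalVertices [cl[j]] = [] := by
          rw [hpv _ hm] at hlt
          simp only [OrderedGraph.finalVertices, List.map_eq_nil_iff, List.filter_eq_nil_iff,
            List.mem_singleton, forall_eq, decide_eq_true_eq]
          omega
        rw [this, List.append_nil]
      rw [hFs]
      exact ⟨hnW, by omega, hc.2.2, hP, ho, hi⟩
    · rw [hpv _ hm] at hle ⊢
      have hFs : D.finalVertices (cl.take (j + 1)) =
          D.finalVertices (cl.take j) ++ [D.π (cl[j].2.getLastD 0 - 1)] := by
        rw [List.take_succ_eq_append_getElem hj, hFapp]
        congr 1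
        have : cl[j].2.getLastD 0 ≤ D.n := by omega
        simp only [OrderedGraph.finalVertices, List.filter_singleton, this]
        rfl
      have hpos : (D.finalVertices (cl.take j)).length < F.length := by
        have : (D.finalVertices (cl.take (j + 1))).length ≤ F.length := by
          have e : F = D.finalVertices (cl.take (j + 1)) ++ D.finalVertices (cl.drop (j + 1)) := by
            rw [← hFapp, List.take_append_drop]
          rw [e, List.length_append]
          omega
        rw [hFs] at this
        simpa using this
      have hlt : cl[j].2.getLastD 0 - 1 < D.n := by omega
      have hπ := D.π_lt _ hlt
      rw [hD.order _ hlt, hFs, hP]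
      simp only [Store.arr_setCell, Store.arr_setReg, ne_eq, Nat.reduceEqDiff,
        not_false_eq_true, Function.update_of_ne, Function.update_self, f3]
      refine ⟨by omega, by omega, by omega, by omega, hnW, by omega, hc.2.2, ?_, ?_, ?_⟩
      · rw [List.length_append, List.length_singleton]
        omega
      · intro k hk
        rw [Function.update_of_ne (by omega)]
        exact ho k hk
      · intro i hi'
        rw [List.length_append, List.length_singleton] at hi'
        rcases Nat.lt_succ_iff_lt_or_eq.1 hi' with h' | rfl
        · rw [Function.update_of_ne (by omega), List.getElem_append_left h']
          exact hi i h'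
        · have e : off + F.length - 1 - (D.finalVertices (cl.take j)).length =
              off + F.length - (D.finalVertices (cl.take j)).length - 1 := by omega
          rw [e, Function.update_self]
          simp
  · rintro s' - ⟨hc, -⟩
    rw [List.drop_length] at hc
    have h0 : s'.reg rC = 0 := hc
    simp [h0]
  · rintro t' s' ht' hf' ⟨-, -, ho, hi⟩ hf
    rw [List.take_length] at hi
    refine post t' s' ?_ hf ?_ ho hi
    · simp at ht'
      omega
    · have := hf'.reg rEnd rfl
      simp at this
      omega

/-! ### The whole program -/

/-- Number the vertices of the next level. -/
def levelStep : Program :=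
  .assign rH (.add (.reg rH) (.lit 1)) ;; refinePhase ;; collectPhase ;; numberPhase

/-- The program that computes LexDFS⁺. Classes up to `n` are reserved as the initial classes of the
levels, so that the counter `rZ` of the classes starts with `n`. -/
def lexDFSProgram : Program :=
  levelPhase ;; tiePhase ;; .assign rZ (.copy (.reg rN)) ;;
  .loop (.lt (.reg rOff) (.reg rN)) levelStep

/-- The state of the main loop after the levels `1, …, h`. -/
structure MainInv (D : OrderedGraph) (lev : ℕ → ℕ) (h : ℕ) (s : Store) : Prop where
  level : s.reg rH = h
  lev_eq : s.arr aLev = lev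
  cnt : ∀ k, 1 ≤ k → s.arr aCnt k = ((Finset.range D.n).filter fun v => lev v = k).card
  numbering : D.Numbering lev h (s.reg rOff) (s.arr aOut)
  events : EventInv lev (D.events (s.arr aOut) (s.reg rOff)) s
  cls : ∀ v, v < D.n → h < lev v → s.arr aCls v = lev v
  nx_zero : ∀ c, h < c → c ≤ D.n → s.arr aNext c = 0
  pv_zero : ∀ c, c ≤ D.n → s.arr aPiv c = 0
  le_class : D.n ≤ s.reg rZ
  class_le : s.reg rZ ≤ D.n + D.weightLe lev h

/-- The time spent on one level is proportional to its weight: each event at one of its vertices is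
read once, and creates at most one class, and each adjacency list of one of its vertices is scanned
once. -/
theorem wp_levelStep {D : OrderedGraph} {lev : ℕ → ℕ} {W h : ℕ} {s : Store} (hD : D.Holds s)
    (hL : D.IsLevel lev) (hle : ∀ v, v < D.n → lev v ≤ D.n) (hW : 2 * D.n + D.size + 1 ≤ W)
    (hne : ∃ v, v < D.n ∧ lev v = h + 1) (hM : MainInv D lev h s) :
    wp W levelStep (fun t' s' => t' ≤ 9 + 33 * D.weight lev (h + 1) ∧ MainInv D lev (h + 1) s')
      0 s := by
  obtain ⟨v₀, hv₀, hlv₀⟩ := hne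
  have hhn : h + 1 ≤ D.n := hlv₀ ▸ hle v₀ hv₀
  have hnum := hM.numbering
  set off := s.reg rOff with hoff
  set τ := s.arr aOut with hτ
  have hoffn : off ≤ D.n := by
    rw [hnum.off_eq]
    exact (Finset.card_filter_le _ _).trans (by simp)
  set E := OrderedGraph.levelEvents lev (D.events τ off) (h + 1) with hE
  have hElen : E.length ≤ D.weight lev (h + 1) := hnum.length_levelEvents_le (h + 1)
  have hwle := OrderedGraph.weightLe_le (D := D) (lev := lev) (h + 1)
  rw [OrderedGraph.weightLe_succ] at hwle
  have hcl := hM.class_le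
  have hEb : ∀ e ∈ E, 1 ≤ e.1 ∧ e.1 ≤ 2 * D.n ∧ e.2 < D.n ∧ lev e.2 = h + 1 := by
    intro e he
    obtain ⟨he, hl⟩ := List.mem_filter.1 he
    obtain ⟨h₁, h₂, h₃⟩ := OrderedGraph.lt_of_mem_events hnum.lt he
    exact ⟨h₁, by omega, h₃, by simpa using hl⟩
  unfold levelStep
  simp only [wp_seq, wp_assign, Operation.val, Operand.val, hM.level]
  refine ⟨by omega, ?_⟩
  refine wp_refinePhase (n := D.n) (h := h + 1) (lev := lev) (E := E)
    (T := (D.events τ off).length) hhn (by simp) (hM.events.chain (h + 1))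
    ((hnum.length_events_le le_rfl).trans (by omega)) (by omega) hEb
    ((OrderedGraph.descending_events hnum.lt).filter _) ?_ ?_ ?_
  · simp; omega
  · have hnx : s.arr aNext (h + 1) = 0 := hM.nx_zero _ (by omega) hhn
    refine ⟨⟨[], rfl⟩, ⟨rfl, by simp, hnx⟩, by simp, by simp, ?_, by simp, by simp, by simp, ?_, ?_,
      ?_, hM.pv_zero, by simp, ?_⟩
    · simpa using hM.pv_zero (h + 1) hhn
    · intro w hw hwh
      simp only [OrderedGraph.labelOf, List.filter_nil, List.map_nil, List.mem_singleton,
        Prod.mk.injEq, and_true, Store.arr_setReg]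
      rw [hM.cls w hw (by omega), hwh]
    · exact fun w hw hwh => hM.cls w hw (by omega)
    · exact fun c hc hcn => hM.nx_zero c (by omega) hcn
    · simpa using hM.le_class
  -- The level is refined: read off its order, and fill it into the output.
  intro t₁ s₁ cl ht₁ hf₁ hI hZ₁
  obtain ⟨tl, rfl⟩ := hI.root
  obtain ⟨hF, hFs⟩ := OrderedGraph.finalVertices_spec hnum.lt hI
  have hFlen := OrderedGraph.length_eq_card hF
    (hFs.imp fun hlt e => by rw [e] at hlt; exact lt_irrefl _ hlt)
  have a1 := hf₁.arr aOut rfl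
  have a2 := hf₁.arr aCnt rfl
  have r1 := hf₁.reg rOff rfl
  have r2 := hf₁.reg rH rfl
  have r3 := hf₁.reg rN rfl
  simp at a1 a2 r1 r2 r3 hZ₁
  rw [← hoff] at r1
  have hD₁ : D.Holds s₁ := hD.congr r3 (hf₁.arr aStart rfl) (hf₁.arr aAdj rfl)
    (hf₁.arr aOrder rfl)
  have hcard := hnum.off_eq
  have hsum : off + (D.finalVertices tl).length ≤ D.n := by
    have h₁ := congrArg Finset.card (OrderedGraph.filter_le_succ lev D.n h)
    have h₂ := Finset.card_filter_le (Finset.range D.n) fun v => lev v ≤ h + 1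
    rw [Finset.card_disjUnion] at h₁
    rw [Finset.card_range] at h₂
    omega
  rw [wp_seq]
  refine wp_collectPhase (h := h + 1) (off := off) (cl := tl) hD₁ (by omega) (by omega) r2 r1
    (by rw [a2, hM.cnt _ (by omega), hFlen]) hsum ?_ (fun e he => hI.piv e (by simp [he]))
    (fun e he => (hI.id_le hhn (List.mem_cons_of_mem _ he)).trans (by omega))
    (fun e he => (hI.pv_le (fun e' he' => (hEb e' he').2.1) (List.mem_cons_of_mem _ he)).trans
      (by omega)) ?_
  · exact hI.chain.2.2
  intro t₂ s₂ ht₂ hf₂ hend hold hnew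
  -- The output is filled: the new vertices continue the numbering, and their events are recorded.
  have hN : D.Numbering lev (h + 1) (off + (D.finalVertices tl).length) (s₂.arr aOut) :=
    hnum.step hL hF hFs (fun k hk => by rw [hold k hk, a1]) hnew
  have hD₂ : D.Holds s₂ := hD₁.congr (hf₂.reg rN rfl) (hf₂.arr aStart rfl) (hf₂.arr aAdj rfl)
    (hf₂.arr aOrder rfl)
  have hev : ∀ p, p ≤ off → D.events (s₂.arr aOut) p = D.events τ p := by
    intro p hp
    induction p with
    | zero => rfl
    | succ p ih =>
      rw [OrderedGraph.events, OrderedGraph.events, ih (by omega), hold p (by omega), a1]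
  have hE₂ : EventInv lev (D.events (s₂.arr aOut) off) s₂ := by
    rw [hev off le_rfl]
    refine hM.events.congr ?_ ?_ ?_ ?_ ?_
    · rw [hf₂.reg rT rfl, hf₁.reg rT rfl]; simp
    · rw [hf₂.arr aEvNext rfl, hf₁.arr aEvNext rfl]; simp
    · rw [hf₂.arr aEvPiv rfl, hf₁.arr aEvPiv rfl]; simp
    · rw [hf₂.arr aEvVert rfl, hf₁.arr aEvVert rfl]; simp
    · rw [hf₂.arr aEvHead rfl, hf₁.arr aEvHead rfl]; simp
  have hlev₂ : s₂.arr aLev = lev := by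
    rw [hf₂.arr aLev rfl, hf₁.arr aLev rfl]
    exact hM.lev_eq
  have hwt := hN.sum_new (fun p hp => by rw [hold p hp, a1]; exact hnum.lev_le p hp)
    (fun k hk => by
      have := hnew ((D.finalVertices tl).length - 1 - k) (by omega)
      have e : off + (D.finalVertices tl).length - 1 - ((D.finalVertices tl).length - 1 - k) =
        off + k := by omega
      rw [e] at this
      rw [this]
      exact ((hF _).1 (List.getElem_mem _)).2)
  refine wp_numberPhase hD₂ hW hlev₂ hle rfl hN ?_ hend hE₂ ?_
  · rw [hf₂.reg rOff rfl, r1]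
  intro t₃ s₃ ht₃ hf₃ hoff₃ hE₃
  have hlen := hI.length
  rw [hwt] at ht₃
  simp only [List.length_cons] at hlen
  refine ⟨by omega, ?_⟩
  have hout : s₃.arr aOut = s₂.arr aOut := hf₃.arr aOut rfl
  have hcls : s₃.arr aCls = s₁.arr aCls := (hf₃.arr aCls rfl).trans (hf₂.arr aCls rfl)
  have hnx : s₃.arr aNext = s₁.arr aNext := (hf₃.arr aNext rfl).trans (hf₂.arr aNext rfl)
  have hpv : s₃.arr aPiv = s₁.arr aPiv := (hf₃.arr aPiv rfl).trans (hf₂.arr aPiv rfl)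
  have hZ : s₃.reg rZ = s₁.reg rZ := (hf₃.reg rZ rfl).trans (hf₂.reg rZ rfl)
  refine ⟨?_, ?_, ?_, ?_, ?_, ?_, ?_, ?_, ?_, ?_⟩
  · rw [hf₃.reg rH rfl, hf₂.reg rH rfl, r2]
  · rw [hf₃.arr aLev rfl, hlev₂]
  · intro k hk
    rw [hf₃.arr aCnt rfl, hf₂.arr aCnt rfl, a2, hM.cnt k hk]
  · rw [hoff₃, hout]
    exact hN
  · rw [hoff₃, hout]
    exact hE₃
  · rw [hcls]
    exact hI.other
  · rw [hnx]
    exact hI.nx_zero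
  · rw [hpv]
    exact hI.pv_zero
  · rw [hZ]
    exact hI.le
  · rw [hZ, OrderedGraph.weightLe_succ]
    omega

theorem wp_lexDFSProgram {D : OrderedGraph} {W : ℕ} {s : Store} (hD : D.Holds s)
    (hW : 2 * D.n + D.size + 1 ≤ W) (hreg : ∀ x, x ≠ 0 → s.reg x = 0)
    (harr : ∀ A, 3 ≤ A → ∀ i, s.arr A i = 0) :
    wp W lexDFSProgram (fun t' s' => t' ≤ 100 * (D.n + D.size + 1) ∧
      ∃ lev h, D.IsLevel lev ∧ D.Numbering lev h D.n (s'.arr aOut)) 0 s := by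
  unfold lexDFSProgram
  rw [wp_seq]
  refine wp_levelPhase hD hW (hreg _ (by decide)) (harr _ (by decide)) (harr _ (by decide))
    (harr _ (by decide)) (harr _ (by decide)) ?_
  intro t₁ s₁ ht₁ hf₁ hL hcls
  have hle : ∀ v, v < D.n → s₁.arr aLev v ≤ D.n := fun v hv =>
    (hL.le v hv).trans hL.add_le
  have hD₁ : D.Holds s₁ := hD.congr (hf₁.reg rN rfl) (hf₁.arr aStart rfl) (hf₁.arr aAdj rfl)
    (hf₁.arr aOrder rfl)
  rw [wp_seq]
  refine wp_tiePhase hD₁ (by omega) rfl hle ⟨?_, fun h => ?_⟩ ?_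
  · rw [hf₁.reg rT rfl, hreg _ (by decide)]
    rfl
  · rw [hf₁.arr aEvHead rfl]
    exact harr _ (by decide) h
  intro t₂ s₂ ht₂ hf₂ hE
  have hD₂ : D.Holds s₂ := hD₁.congr (hf₂.reg rN rfl) (hf₂.arr aStart rfl) (hf₂.arr aAdj rfl)
    (hf₂.arr aOrder rfl)
  simp only [wp_seq, wp_assign, Operation.val, Operand.val, hD₂.size]
  refine ⟨by omega, ?_⟩
  set lev := s₁.arr aLev with hlev
  have hlevel := hL.isLevel
  have hoff : s₂.reg rOff = 0 := by
    rw [hf₂.reg rOff rfl, hf₁.reg rOff rfl, hreg _ (by decide)]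
  have hDf : ∀ {s'}, Frame levelStep (s₂.setReg rZ D.n) s' → D.Holds s' := fun hf =>
    hD₂.congr (hf.reg rN rfl) (hf.arr aStart rfl) (hf.arr aAdj rfl) (hf.arr aOrder rfl)
  refine wp_loop (fun h s' => MainInv D lev h s') (s₁.reg rM)
    (fun h => 9 + 33 * D.weight lev (h + 1)) ?_ ?_ ?_ ?_
  · refine ⟨?_, ?_, ?_, ?_, ?_, ?_, ?_, ?_, ?_, ?_⟩
    · simp [hf₂.reg rH rfl, hf₁.reg rH rfl, hreg]
    · exact hf₂.arr aLev rfl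
    · intro k hk
      rw [Store.arr_setReg, hf₂.arr aCnt rfl]
      exact hL.cnt_eq k hk
    · simp only [Store.reg_setReg, ne_eq, Nat.reduceEqDiff, not_false_eq_true,
        Function.update_of_ne, hoff]
      refine ⟨?_, by simp, by simp, by simp, fun v hv hv0 => ?_, by simp, by simp⟩
      · symm
        rw [Finset.card_eq_zero, Finset.filter_eq_empty_iff]
        intro v hv
        have := hlevel.pos v (by simpa using hv)
        omega
      · have := hlevel.pos v hv
        omega
    · simp only [Store.reg_setReg, ne_eq, Nat.reduceEqDiff, not_false_eq_true,
        Function.update_of_ne, hoff]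
      exact hE.congr (by simp) rfl rfl rfl rfl
    · intro v hv _
      rw [Store.arr_setReg, hf₂.arr aCls rfl]
      exact hcls v hv
    · intro c _ _
      rw [Store.arr_setReg, hf₂.arr aNext rfl, hf₁.arr aNext rfl, harr _ (by decide)]
    · intro c _
      rw [Store.arr_setReg, hf₂.arr aPiv rfl, hf₁.arr aPiv rfl, harr _ (by decide)]
    · simp
    · simp
  · intro h s' hh hf hM
    refine ⟨?_, wp_levelStep (hDf hf) hlevel hle hW (hL.nonempty (h + 1) (by omega) hh) hM⟩
    obtain ⟨v, hv, hvl⟩ := hL.nonempty (h + 1) (by omega) hh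
    simp only [Test.holds, Operand.val, (hDf hf).size, hM.numbering.off_eq]
    refine lt_of_lt_of_eq (Finset.card_lt_card (t := Finset.range D.n)
      ⟨Finset.filter_subset _ _, fun hsub => ?_⟩) (Finset.card_range _)
    have := (Finset.mem_filter.1 (hsub (by simpa using hv : v ∈ Finset.range D.n))).2
    omega
  · intro s' hf hM
    have : s'.reg rOff = D.n := by
      rw [hM.numbering.off_eq, Finset.filter_true_of_mem, Finset.card_range]
      intro v hv
      exact hL.le v (by simpa using hv)
    simp [Test.holds, Operand.val, this, (hDf hf).size]
  · intro t' s' ht' hf hM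
    have hoff : s'.reg rOff = D.n := by
      rw [hM.numbering.off_eq, Finset.filter_true_of_mem, Finset.card_range]
      intro v hv
      exact hL.le v (by simpa using hv)
    have hnum := hM.numbering
    rw [hoff] at hnum
    refine ⟨?_, lev, _, hlevel, hnum⟩
    have hw := OrderedGraph.sum_weight_le (D := D) (lev := lev) (s₁.reg rM)
    have hadd := hL.add_le
    simp only [Finset.sum_add_distrib, ← Finset.mul_sum, Finset.sum_const, Finset.card_range,
      smul_eq_mul] at ht'
    omega

/-! ### From stores to graphs on `Fin n` -/

open OrderedGraph

/-- A store that holds an input holds an ordered graph, whose functions take the values `0` and `[]`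
outside of the range of the vertices. -/
theorem exists_orderedGraph {n : ℕ} {G : SimpleGraph (Fin n)} {σ : Fin n ≃ Fin n}
    (hσ : IsCocomparabilityOrdering G σ) {s : Store} (hs : IsInput G σ s) :
    ∃ D : OrderedGraph, D.n = n ∧ D.Holds s ∧ D.size = 2 * G.edgeSet.ncard ∧
      (∀ u v : Fin n, (v : ℕ) ∈ D.N u ↔ G.Adj u v) ∧ ∀ v : Fin n, D.pos v = σ.symm v := by
  classical
  choose l hnd hmem hstart hadj using hs.adjList
  have hN : ∀ v : Fin n, (if h : (v : ℕ) < n then (l ⟨v, h⟩).map Fin.val else []) =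
      (l v).map Fin.val := fun v => by simp
  have hNm : ∀ u v : Fin n, (v : ℕ) ∈ (l u).map Fin.val ↔ G.Adj u v := fun u v => by
    simp [← hmem, Fin.val_inj]
  let D : OrderedGraph :=
    { n := n
      N := fun v => if h : v < n then (l ⟨v, h⟩).map Fin.val else []
      π := fun i => if h : i < n then σ ⟨i, h⟩ else 0
      pos := fun v => if h : v < n then σ.symm ⟨v, h⟩ else 0
      nodup := fun v hv => by
        simpa [hv] using (hnd ⟨v, hv⟩).map Fin.val_injective
      lt := fun v hv u hu => by
        simp only [hv, dite_true, List.mem_map] at hu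
        obtain ⟨u, -, rfl⟩ := hu
        exact u.2
      symm := fun v hv u hu h => by
        simp only [hv, hu, dite_true] at h ⊢
        exact (hNm ⟨u, hu⟩ ⟨v, hv⟩).2 ((hNm ⟨v, hv⟩ ⟨u, hu⟩).1 h).symm
      irrefl := fun v hv h => by
        simp only [hv, dite_true] at h
        exact G.loopless.irrefl _ ((hNm ⟨v, hv⟩ ⟨v, hv⟩).1 h)
      π_lt := fun i hi => by simp [hi]
      pos_lt := fun v hv => by simp [hv]
      pos_π := fun i hi => by simp [hi]
      π_pos := fun v hv => by simp [hv]
      umbrella := fun u hu v hv w hw h₁ h₂ h => by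
        simp only [hu, hv, hw, dite_true] at h₁ h₂ h ⊢
        have := hσ (σ.symm ⟨u, hu⟩) (σ.symm ⟨v, hv⟩) (σ.symm ⟨w, hw⟩) h₁ h₂
          (by simpa using (hNm ⟨u, hu⟩ ⟨w, hw⟩).1 h)
        simp only [Equiv.apply_symm_apply] at this
        exact this.imp (hNm ⟨u, hu⟩ ⟨v, hv⟩).2 (hNm ⟨v, hv⟩ ⟨w, hw⟩).2 }
  have hDN : ∀ v : Fin n, D.N v = (l v).map Fin.val := hN
  refine ⟨D, rfl, ⟨hs.size, ?_, ?_, ?_⟩, ?_, fun u v => ?_, fun v => by simp [D]⟩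
  · intro v hv
    induction v with
    | zero => simpa using hs.start
    | succ v ih =>
      have h := hstart ⟨v, hv⟩
      rw [Finset.sum_range_succ, ← ih (Nat.le_of_succ_le hv)]
      refine h.trans ?_
      have := congrArg List.length (hDN ⟨v, hv⟩)
      rw [List.length_map] at this
      rw [← this]
  · intro v hv k hk
    have := hDN ⟨v, hv⟩
    simp only at this
    have hk' : k < (l ⟨v, hv⟩).length := by simpa [this] using hk
    rw [hadj ⟨v, hv⟩ k hk']
    simp [this]
  · intro i hi
    have hi' : i < n := hi
    rw [hs.order ⟨i, hi⟩]
    simp [D, hi']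
  · have h₁ : D.size = ∑ v : Fin n, G.degree v := by
      rw [size, Finset.sum_range]
      refine Finset.sum_congr rfl fun v _ => ?_
      rw [hDN, List.length_map, ← List.toFinset_card_of_nodup (hnd v),
        ← SimpleGraph.card_neighborFinset_eq_degree]
      congr 1
      ext u
      simp [hmem]
    rw [h₁, G.sum_degrees_eq_twice_card_edges, Set.ncard_eq_toFinset_card']
    rfl
  · rw [hDN]
    exact hNm u v

theorem lexDFSLabel_eq_lbl {D : OrderedGraph} {n : ℕ} {G : SimpleGraph (Fin n)}
    (hadj : ∀ u v : Fin n, (v : ℕ) ∈ D.N u ↔ G.Adj u v) {τ : Fin n ≃ Fin n} {t : ℕ → ℕ}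
    (hτ : ∀ i : Fin n, t i = τ i) (w : Fin n) {i : ℕ} (hi : i ≤ n) :
    lexDFSLabel G τ i w = D.lbl t i w := by
  induction i with
  | zero => rfl
  | succ i ih =>
    have h : (∃ h : i < n, G.Adj (τ ⟨i, h⟩) w) ↔ (w : ℕ) ∈ D.N (t i) := by
      rw [hτ ⟨i, hi⟩, hadj]
      exact ⟨fun h => h.2, fun h => ⟨hi, h⟩⟩
    rw [lexDFSLabel, lbl, ih (by omega)]
    simp only [h]

end CocompLexDFS

theorem proposition1 :
    ∃ (P : Program) (C : ℕ), ∀ (n : ℕ) (G : SimpleGraph (Fin n)) (σ : Fin n ≃ Fin n),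
      IsCocomparabilityGraph G → IsCocomparabilityOrdering G σ →
      ∀ s : Store, IsInput G σ s →
        ∃ τ : Fin n ≃ Fin n, IsLexDFSPlus G σ τ ∧
          ∃ (t : ℕ) (s' : Store), Exec (C * (n + G.edgeSet.ncard + 1)) P s t s' ∧
            t ≤ C * (n + G.edgeSet.ncard + 1) ∧ IsOutput τ s' := by
  refine ⟨lexDFSProgram, 200, fun n G σ _ hσ s hs => ?_⟩
  obtain ⟨D, rfl, hD, hsize, hadj, hpos⟩ := exists_orderedGraph hσ hs
  obtain ⟨t', s', hexec, ht', lev, h, hL, hN⟩ :=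
    wp_lexDFSProgram (W := 200 * (D.n + G.edgeSet.ncard + 1)) hD (by omega) hs.reg_zero hs.arr_zero
  have hinj : Function.Injective fun i : Fin D.n => (⟨s'.arr 3 i, hN.lt i i.2⟩ : Fin D.n) :=
    fun i j e => Fin.ext (hN.inj i i.2 j j.2 (Fin.mk.inj e))
  let τ : Fin D.n ≃ Fin D.n := Equiv.ofBijective _ (Finite.injective_iff_bijective.1 hinj)
  have hτ : ∀ i : Fin D.n, s'.arr 3 i = τ i := fun i => rfl
  have rule : ∀ i j : Fin D.n, i ≤ j → _ := fun i j hij =>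
    hL.lexDFSPlus_rule hN.lt hN.inj
      (fun v hv => by
        obtain ⟨i, hi⟩ := τ.surjective ⟨v, hv⟩
        exact ⟨i, i.2, by rw [hτ, hi]⟩) hN.mono hN.same (p := i) (q := j) hij j.2
  refine ⟨τ, ⟨fun i j hij => ?_, fun i j hij he => ?_⟩, t', s', hexec, by omega, fun i => hτ i⟩
  · rw [lexDFSLabel_eq_lbl hadj hτ _ i.2.le, lexDFSLabel_eq_lbl hadj hτ _ i.2.le]
    exact (rule i j hij).1
  · rw [lexDFSLabel_eq_lbl hadj hτ _ i.2.le, lexDFSLabel_eq_lbl hadj hτ _ i.2.le] at he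
    have := (rule i j hij).2 he
    rw [hτ, hτ, hpos, hpos] at this
    exact this
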